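/- Conventions. All manifolds are smooth ($C^\infty$), finite-dimensional, Hausdorff, paracompact and without boundary. Let $M$ be a manifold. A local vectorfield on $M$ is a smooth vectorfield $X$ defined on some (possibly empty) open subset $\operatorname{dom} X$ of $M$; $\mathfrak X_{loc}(M)$ is the set of all of them. For $X\in\mathfrak X_{loc}(M)$, $Fl^X_t$ denotes the time-$t$ map of the maximal local flow of $X$ on $\operatorname{dom} X$; it is a diffeomorphism between open subsets of $M$. For $X,Y\in\mathfrak X_{loc}(M)$ and $t\in\mathbb R$, the pullback $(Fl^X_t)^*Y$ is the local vectorfield $x\mapsto (T_xFl^X_t)^{-1}\,Y(Fl^X_t(x))$, defined at those $x$ in the domain of $Fl^X_t$ with $Fl^X_t(x)\in\operatorname{dom} Y$. A distribution $H$ on $M$ is a choice of a linear subspace $H_x\subset T_xM$ for each $x\in M$ (the dimension may vary). A set $\mathcal V\subset\mathfrak X_{loc}(M)$ spans $H$ if, for every $x\in M$, $H_x$ is the linear hull of $\{X(x): X\in\mathcal V,\ x\in\operatorname{dom}X\}$. Let $\mathfrak X_{loc,H}(M)$ be the set of local vectorfields $X$ with $X(x)\in H_x$ for all $x\in\operatorname{dom}X$.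 $H$ is smooth if $\mathfrak X_{loc,H}(M)$ spans $H$. $H$ is integrable if for every $x\in M$ there are a connected manifold $N$ and an injective immersion $i:N\to M$ with $x\in i(N)$ and $T_yi(T_yN)=H_{i(y)}$ for all $y\in N$. A set $\mathcal V\subset\mathfrak X_{loc}(M)$ is stable if $(Fl^X_t)^*Y\in\mathcal V$ for all $X,Y\in\mathcal V$ and all $t\in\mathbb R$; $\mathcal S(\mathcal V)$ is the minimal stable set containing $\mathcal V$. Finally, $\mathfrak{aut}(H)$ is the set of $X\in\mathfrak X_{loc}(M)$ such that $T_xFl^X_t(H_x)\subset H_{Fl^X_t(x)}$ for all $t\in\mathbb R$ and all $x$ in the domain of $Fl^X_t$. Theorem (Stefan–Sussmann). Let $H$ be a smooth distribution on a manifold $M$. Then the following conditions are equivalent: 1. $H$ is integrable. 2. $\mathfrak X_{loc,H}(M)$ is stable. 3. There exists a subset $\mathcal V\subset\mathfrak X_{loc}(M)$ such that $\mathcal S(\mathcal V)$ spans $H$. 4. $\mathfrak{aut}(H)\cap\mathfrak X_{loc,H}(M)$ spans $H$. -/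

import Mathlib

open scoped Manifold ContDiff Topology

universe u v

namespace StefanSussmann

variable {E : Type v} [NormedAddCommGroup E] [NormedSpace ℝ E]

/-- A (possibly singular) distribution on `M`: a linear subspace of the tangent space at each point,
with no regularity condition. -/
def Distribution (E : Type v) [NormedAddCommGroup E] [NormedSpace ℝ E]
    (M : Type u) [TopologicalSpace M] [ChartedSpace E M] : Type (max u v) :=
  (x : M) → Submodule ℝ (TangentSpace 𝓘(ℝ, E) x)

/-- A smooth vector field on an open subset of `M` (possibly empty).  The function is extended by
zero outside of the open domain, so that two local vector fields are equal if and only if they have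
the same domain and the same values on it. -/
@[ext]
structure LocalVectorField (E : Type v) [NormedAddCommGroup E] [NormedSpace ℝ E]
    (M : Type u) [TopologicalSpace M] [ChartedSpace E M] [IsManifold 𝓘(ℝ, E) ∞ M] where
  /-- The domain of definition. -/
  domain : Set M
  /-- The value at each point of the domain. -/
  toFun : (x : M) → TangentSpace 𝓘(ℝ, E) x
  isOpen_domain : IsOpen domain
  smooth : ContMDiffOn 𝓘(ℝ, E) 𝓘(ℝ, E).tangent ∞
    (fun x ↦ (⟨x, toFun x⟩ : TangentBundle 𝓘(ℝ, E) M)) domain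
  zero_outside : ∀ x, x ∉ domain → toFun x = 0

variable {M : Type u} [TopologicalSpace M] [ChartedSpace E M] [IsManifold 𝓘(ℝ, E) ∞ M]

namespace LocalVectorField

/-- The maximal integral curve of `X` starting at `x` is defined at time `t` and has the value `y`
there: some integral curve of `X`, running inside the domain of `X` and defined on an open interval
that contains `0` and `t`, starts at `x` and is at `y` at time `t`. -/
def FlowsTo (X : LocalVectorField E M) (t : ℝ) (x y : M) : Prop :=
  ∃ (γ : ℝ → M) (a b : ℝ), (0 : ℝ) ∈ Set.Ioo a b ∧ t ∈ Set.Ioo a b ∧ γ 0 = x ∧ γ t = y ∧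
    (∀ s ∈ Set.Ioo a b, γ s ∈ X.domain) ∧
    IsMIntegralCurveOn (I := 𝓘(ℝ, E)) γ X.toFun (Set.Ioo a b)

/-- The domain of the time-`t` map of the maximal local flow of `X`. -/
def flowDomain (X : LocalVectorField E M) (t : ℝ) : Set M :=
  {x | ∃ y, X.FlowsTo t x y}

open Classical in
/-- The time-`t` map of the maximal local flow of `X`; it is meaningful on `X.flowDomain t`, and
takes the irrelevant value `x` at the other points. -/
noncomputable def flow (X : LocalVectorField E M) (t : ℝ) (x : M) : M :=
  if h : ∃ y, X.FlowsTo t x y then h.choose else x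

/-- `Z` is the pullback of the local vector field `Y` along the local diffeomorphism `Fl` which is
the time-`t` map of the flow of `X`: it is defined at those `x` in the domain of `Fl` for which
`Fl x` is in the domain of `Y`, with the value `(T_x Fl)⁻¹ (Y (Fl x))`. -/
def IsFlowPullback (X : LocalVectorField E M) (t : ℝ) (Y Z : LocalVectorField E M) : Prop :=
  Z.domain = {x | x ∈ X.flowDomain t ∧ X.flow t x ∈ Y.domain} ∧
  ∀ x ∈ Z.domain,
    Z.toFun x = VectorField.mpullback 𝓘(ℝ, E) 𝓘(ℝ, E) (X.flow t) Y.toFun x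

end LocalVectorField

/-- A set of local vector fields is stable if it contains, with `X` and `Y`, the pullback of `Y`
along every time-`t` map of the flow of `X`. -/
def IsStable (𝒱 : Set (LocalVectorField E M)) : Prop :=
  ∀ X ∈ 𝒱, ∀ Y ∈ 𝒱, ∀ t : ℝ, ∃ Z ∈ 𝒱, X.IsFlowPullback t Y Z

/-- The minimal stable set of local vector fields that contains `𝒱`. -/
def stableHull (𝒱 : Set (LocalVectorField E M)) : Set (LocalVectorField E M) :=
  ⋂₀ {𝒲 | 𝒱 ⊆ 𝒲 ∧ IsStable 𝒲}

/-- `𝒱` spans `H`: at each point `x`, the subspace `H x` is the linear hull of the values at `x` of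
those members of `𝒱` that are defined at `x`. -/
def Spans (𝒱 : Set (LocalVectorField E M)) (H : Distribution E M) : Prop :=
  ∀ x : M, H x = Submodule.span ℝ {w | ∃ X ∈ 𝒱, x ∈ X.domain ∧ X.toFun x = w}

/-- The set of local horizontal vector fields. -/
def horizontalFields (H : Distribution E M) : Set (LocalVectorField E M) :=
  {X | ∀ x ∈ X.domain, X.toFun x ∈ H x}

/-- A distribution is smooth if it is spanned by its local horizontal vector fields. -/
def IsSmoothDistribution (H : Distribution E M) : Prop :=
  Spans (horizontalFields H) H

/-- The set of infinitesimal automorphisms of `H`. -/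
def infinitesimalAut (H : Distribution E M) : Set (LocalVectorField E M) :=
  {X | ∀ (t : ℝ), ∀ x ∈ X.flowDomain t, ∀ w ∈ H x,
    mfderiv 𝓘(ℝ, E) 𝓘(ℝ, E) (X.flow t) x w ∈ H (X.flow t x)}

/-- The `k`-dimensional manifold `N` with `i : N → M` is an integral manifold of `H`: `N` is connected, and `i` is an injective immersion
with `T_y i (T_y N) = H (i y)` for all `y`. -/
structure IsIntegralManifold (H : Distribution E M) (k : ℕ) (N : Type u) [TopologicalSpace N]
    [ChartedSpace (EuclideanSpace ℝ (Fin k)) N] (i : N → M) : Prop where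
  connected : ConnectedSpace N
  smooth : ContMDiff (𝓡 k) 𝓘(ℝ, E) ∞ i
  injective : Function.Injective i
  injective_mfderiv : ∀ y : N, Function.Injective (mfderiv (𝓡 k) 𝓘(ℝ, E) i y)
  range_mfderiv : ∀ y : N,
    LinearMap.range (mfderiv (𝓡 k) 𝓘(ℝ, E) i y).toLinearMap = H (i y)

/-- A distribution is integrable if every point lies in an integral manifold. (As the map of an
integral manifold is injective, it is no restriction to take these in the universe of `M`.) -/
def IsIntegrable (H : Distribution E M) : Prop :=
  ∀ x : M, ∃ (k : ℕ) (N : Type u) (_ : TopologicalSpace N)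
    (_ : ChartedSpace (EuclideanSpace ℝ (Fin k)) N) (_ : IsManifold (𝓡 k) ∞ N)
    (_ : T2Space N) (_ : ParacompactSpace N) (i : N → M),
    IsIntegralManifold H k N i ∧ x ∈ Set.range i

end StefanSussmann

/-! The central notion is a plaque: a map from a Euclidean space into `M` that is, near a given
parameter, an immersion whose tangent spaces are exactly those of `H`. Integrability amounts to
having a plaque through every point (`IsIntegrable.exists_isPlaqueAt`,
`isIntegrable_of_exists_isPlaqueAt`).

Suppose `H` is integrable. A horizontal field lifts to a smooth field on a plaque
(`exists_lift_of_isPlaqueAt`), and the plaque carries the flow of the lift to the flow of the field.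
Hence for short times the flow maps `H` isomorphically onto `H`, and connectedness of the time
interval extends this to all times (`IsIntegrable.horizontalFields_subset`). Horizontal fields are
therefore infinitesimal automorphisms, and their pullbacks along each other stay horizontal: this is
stability.

Conversely, let `H` be spanned by infinitesimal automorphisms. Choose fields `X i` whose values at
`x₀` form a basis of `H x₀`, and compose their flows, with the times as coordinates. The derivative
at `0` sends the coordinate vectors to this basis, so the composite is an immersion nearby. Its
derivatives have values in `H`, because each flow preserves `H`, and the rank of `H` is constant on
its image, because the image is reached from `x₀` by these flows. So it is a plaque
(`isIntegrable_of_spans`). Condition 4 fits this directly. Condition 3 does too, since a stable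
spanning set consists of infinitesimal automorphisms (`IsStable.subset_infinitesimalAut`).

All of this rests on the maximal flow having an open domain and being jointly smooth in time and
initial point (`flowSmoothAt`). Locally this comes from the implicit function method in a space of
curves: the integral equation is smooth there because composition with a smooth map is a smooth
operator (`contDiff_comp_continuousMap`). -/

namespace StefanSussmann

/-! ### Smoothness of composition operators on spaces of continuous functions -/

section CompositionOperator

variable {K : Type*} [TopologicalSpace K] [CompactSpace K]
  {F : Type v} [NormedAddCommGroup F] [NormedSpace ℝ F]
  {G : Type v} [NormedAddCommGroup G] [NormedSpace ℝ G]

/-- Pointwise evaluation of a continuous family of operators on a continuous function. -/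
noncomputable def pointwiseApply : C(K, F →L[ℝ] G) →L[ℝ] C(K, F) →L[ℝ] C(K, G) :=
  LinearMap.mkContinuous₂
    (LinearMap.mk₂ ℝ (fun (A : C(K, F →L[ℝ] G)) (h : C(K, F)) ↦
        (⟨fun s ↦ A s (h s), by fun_prop⟩ : C(K, G)))
      (fun _ _ _ ↦ by ext; simp) (fun _ _ _ ↦ by ext; simp)
      (fun _ _ _ ↦ by ext; simp) (fun _ _ _ ↦ by ext; simp)) 1 (fun A h ↦ by
        rw [ContinuousMap.norm_le _ (by positivity)]
        intro s
        simp only [LinearMap.mk₂_apply, ContinuousMap.coe_mk, one_mul]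
        exact ((A s).le_opNorm _).trans
          (mul_le_mul (A.norm_coe_le_norm s) (h.norm_coe_le_norm s) (norm_nonneg _) (norm_nonneg A)))

/-- The mean value inequality bounds the remainder at each point of `K`; compactness of the image of
`γ` makes the bound uniform over `K`. -/
theorem hasFDerivAt_comp_continuousMap {f : C(F, G)} {f' : C(F, F →L[ℝ] G)}
    (hf : ∀ x, HasFDerivAt f (f' x) x) (γ : C(K, F)) :
    HasFDerivAt (fun γ : C(K, F) ↦ f.comp γ) (pointwiseApply (f'.comp γ)) γ := by
  rw [hasFDerivAt_iff_isLittleO_nhds_zero, Asymptotics.isLittleO_iff]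
  intro c hc
  have hcomp : IsCompact (Set.range γ) := isCompact_range γ.continuous
  -- `f'` need not be uniformly continuous, but one `δ` serves all centres in the compact image of
  -- `γ`.
  have hu := hcomp.uniformContinuousAt_of_continuousAt f'
    (fun a _ ↦ f'.continuous.continuousAt) (Metric.dist_mem_uniformity hc)
  obtain ⟨δ, hδ, hu⟩ := Metric.mem_uniformity_dist.1 hu
  filter_upwards [Metric.ball_mem_nhds (0 : C(K, F)) hδ] with h hh
  rw [ContinuousMap.norm_le _ (by positivity)]
  intro s
  have hs : ‖h s‖ < δ := (h.norm_coe_le_norm s).trans_lt (by simpa using hh)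
  have key := (convex_ball (γ s) δ).norm_image_sub_le_of_norm_hasFDerivWithin_le'
    (f := f) (f' := f') (φ := f' (γ s)) (C := c) (x := γ s) (y := γ s + h s)
    (fun x _ ↦ (hf x).hasFDerivWithinAt)
    (fun x hx ↦ by
      have := @hu (γ s) x (by rw [dist_comm]; exact hx) ⟨s, rfl⟩
      rw [← dist_eq_norm, dist_comm]
      exact le_of_lt this)
    (Metric.mem_ball_self hδ) (by simpa using hs)
  simp only [add_sub_cancel_left] at key
  exact key.trans (mul_le_mul_of_nonneg_left (h.norm_coe_le_norm s) hc.le)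

/-- The derivative is again a composition operator, for `f'`, followed by a continuous linear map.
The target changes to a space of operators, so the induction quantifies over `G`. -/
theorem contDiff_comp_continuousMap_nat (n : ℕ) : ∀ {G : Type v} [NormedAddCommGroup G]
    [NormedSpace ℝ G] {f : C(F, G)}, ContDiff ℝ ∞ f →
    ContDiff ℝ n (fun γ : C(K, F) ↦ f.comp γ) := by
  induction n with
  | zero =>
    intro G _ _ f _
    exact contDiff_zero.2 (ContinuousMap.continuous_postcomp f)
  | succ n ih =>
    intro G _ _ f hf
    let f' : C(F, F →L[ℝ] G) := ⟨fderiv ℝ f, hf.continuous_fderiv (by simp)⟩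
    have hf' : ContDiff ℝ ∞ f' := hf.fderiv_right (m := ∞) (by simp)
    have hd := hasFDerivAt_comp_continuousMap (K := K) (f := f) (f' := f')
      (fun x ↦ (hf.differentiable (by simp) x).hasFDerivAt)
    push_cast
    rw [contDiff_succ_iff_fderiv]
    refine ⟨fun γ ↦ (hd γ).differentiableAt, by simp, ?_⟩
    rw [show fderiv ℝ (fun γ : C(K, F) ↦ f.comp γ) = fun γ ↦ pointwiseApply (f'.comp γ) from
      funext fun γ ↦ (hd γ).fderiv]
    exact pointwiseApply.contDiff.comp (ih hf')

/-- Composition with a smooth map is a smooth operator on spaces of continuous functions. -/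
theorem contDiff_comp_continuousMap {f : C(F, G)} (hf : ContDiff ℝ ∞ f) :
    ContDiff ℝ ∞ (fun γ : C(K, F) ↦ f.comp γ) :=
  contDiff_infty.2 fun n ↦ contDiff_comp_continuousMap_nat n hf

end CompositionOperator

/-! ### Smooth local flows in a normed space -/

section LocalFlow

variable {F : Type v} [NormedAddCommGroup F] [NormedSpace ℝ F]

/-- The primitive vanishing at `0` of a continuous function on the unit interval. -/
noncomputable def primitive : C(unitInterval, F) →L[ℝ] C(unitInterval, F) :=
  LinearMap.mkContinuous
    { toFun := fun γ ↦ ⟨fun s ↦ ∫ τ in (0 : ℝ)..s, Set.IccExtend zero_le_one γ τ,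
        (intervalIntegral.continuous_primitive
          (fun a b ↦ (γ.continuous.Icc_extend' (h := zero_le_one)).intervalIntegrable a b) 0).comp
            continuous_subtype_val⟩
      map_add' := fun γ γ' ↦ by
        ext s
        exact intervalIntegral.integral_add
          ((γ.continuous.Icc_extend' (h := zero_le_one)).intervalIntegrable 0 s)
          ((γ'.continuous.Icc_extend' (h := zero_le_one)).intervalIntegrable 0 s)
      map_smul' := fun c γ ↦ by
        ext s
        exact intervalIntegral.integral_smul c _ } 1 (fun γ ↦ by
    rw [ContinuousMap.norm_le _ (by positivity)]
    intro s
    have := intervalIntegral.norm_integral_le_of_norm_le_const (a := 0) (b := (s : ℝ)) (C := ‖γ‖)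
      (f := Set.IccExtend zero_le_one γ) (fun x _ ↦ γ.norm_coe_le_norm _)
    refine this.trans ?_
    rw [sub_zero, abs_of_nonneg s.2.1, mul_comm]
    exact mul_le_mul_of_nonneg_right s.2.2 (norm_nonneg _))

theorem primitive_apply (γ : C(unitInterval, F)) (s : unitInterval) :
    primitive γ s = ∫ τ in (0 : ℝ)..s, Set.IccExtend zero_le_one γ τ := rfl

/-- The constant curves. -/
noncomputable def constCurve : F →L[ℝ] C(unitInterval, F) :=
  LinearMap.mkContinuous
    { toFun := fun x ↦ ContinuousMap.const unitInterval x
      map_add' := fun _ _ ↦ rfl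
      map_smul' := fun _ _ ↦ rfl } 1 (fun x ↦ by
    rw [ContinuousMap.norm_le _ (by positivity)]
    intro s
    exact (one_mul ‖x‖).ge)

@[simp]
theorem constCurve_apply (x : F) (s : unitInterval) : constCurve x s = x := rfl

/-- The second component vanishes exactly at the solutions of the rescaled integral equation
`γ = x + T ∫ f ∘ γ`. -/
noncomputable def integralEquation (f : C(F, F)) (q : (ℝ × F) × C(unitInterval, F)) :
    (ℝ × F) × C(unitInterval, F) :=
  (q.1, q.2 - (constCurve q.1.2 + q.1.1 • primitive (f.comp q.2)))

theorem contDiff_integralEquation {f : C(F, F)} (hf : ContDiff ℝ ∞ f) :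
    ContDiff ℝ ∞ (integralEquation f) := by
  have h := (contDiff_comp_continuousMap (K := unitInterval) hf)
  have h1 : ContDiff ℝ ∞ (fun q : (ℝ × F) × C(unitInterval, F) ↦ f.comp q.2) := h.comp contDiff_snd
  have h2 : ContDiff ℝ ∞ (fun q : (ℝ × F) × C(unitInterval, F) ↦ primitive (f.comp q.2)) :=
    (ContinuousLinearMap.contDiff (primitive (F := F))).comp h1
  have h3 : ContDiff ℝ ∞ (fun q : (ℝ × F) × C(unitInterval, F) ↦ constCurve q.1.2) :=
    (ContinuousLinearMap.contDiff (constCurve (F := F))).comp (contDiff_snd.comp contDiff_fst)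
  exact contDiff_fst.prodMk (contDiff_snd.sub (h3.add ((contDiff_fst.comp contDiff_fst).smul h2)))

/-- At time `0` the factor in front of the primitive vanishes, so the variation of the curve enters
only through the identity. The derivative is block triangular with identity blocks, hence
invertible. -/
theorem hasFDerivAt_integralEquation {f : C(F, F)} (hf : ContDiff ℝ ∞ f) (x : F)
    (γ : C(unitInterval, F)) :
    ∃ e : ((ℝ × F) × C(unitInterval, F)) ≃L[ℝ] ((ℝ × F) × C(unitInterval, F)),
      HasFDerivAt (integralEquation f) (e : _ →L[ℝ] _) ((0, x), γ) := by
  let T : (ℝ × F) →L[ℝ] C(unitInterval, F) :=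
    -(constCurve.comp (ContinuousLinearMap.snd ℝ ℝ F) +
      (ContinuousLinearMap.fst ℝ ℝ F).smulRight (primitive (f.comp γ)))
  refine ⟨ContinuousLinearEquiv.skewProd (.refl ℝ _) (.refl ℝ _) T, ?_⟩
  have h := (contDiff_comp_continuousMap (K := unitInterval) hf)
  have h1 : ContDiff ℝ ∞ (fun q : (ℝ × F) × C(unitInterval, F) ↦ f.comp q.2) := h.comp contDiff_snd
  have h2 : ContDiff ℝ ∞ (fun q : (ℝ × F) × C(unitInterval, F) ↦ primitive (f.comp q.2)) :=
    (ContinuousLinearMap.contDiff (primitive (F := F))).comp h1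
  have h4 := (h2.differentiable (by simp) ((0, x), γ)).hasFDerivAt
  have h5 : HasFDerivAt (fun q : (ℝ × F) × C(unitInterval, F) ↦ q.1.1)
    ((ContinuousLinearMap.fst ℝ ℝ F).comp (ContinuousLinearMap.fst ℝ _ _)) ((0, x), γ) :=
    ContinuousLinearMap.hasFDerivAt
      ((ContinuousLinearMap.fst ℝ ℝ F).comp (ContinuousLinearMap.fst ℝ (ℝ × F) C(unitInterval, F)))
  have h6 : HasFDerivAt (fun q : (ℝ × F) × C(unitInterval, F) ↦ constCurve q.1.2)
    (constCurve.comp ((ContinuousLinearMap.snd ℝ ℝ F).comp (ContinuousLinearMap.fst ℝ _ _)))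
      ((0, x), γ) :=
    ContinuousLinearMap.hasFDerivAt (constCurve.comp
      ((ContinuousLinearMap.snd ℝ ℝ F).comp (ContinuousLinearMap.fst ℝ (ℝ × F) C(unitInterval, F))))
  refine (hasFDerivAt_fst.prodMk (hasFDerivAt_snd.sub (h6.add (h5.smul h4)))).congr_fderiv ?_
  ext q <;> simp [T, sub_eq_add_neg]

variable [CompleteSpace F]

/-- The local flow of a globally defined smooth vector field depends smoothly on time and on the
initial value. -/
theorem exists_smooth_local_flow_of_contDiff {f : F → F} (hf : ContDiff ℝ ∞ f) (x₀ : F) :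
    ∃ φ : ℝ → F → F, ∀ᶠ p : ℝ × F in 𝓝 (0, x₀), φ 0 p.2 = p.2 ∧
      HasDerivAt (φ · p.2) (f (φ p.1 p.2)) p.1 ∧
      ContDiffAt ℝ ∞ (fun q : ℝ × F ↦ φ q.1 q.2) p := by
  obtain ⟨ε, hε, a, r, L, K, hr, hpl⟩ :=
    IsPicardLindelof.of_contDiffAt_one ((hf.of_le (by simp)).contDiffAt (x := x₀))
  obtain ⟨α, hα, hαc⟩ := (hpl 0).exists_forall_mem_closedBall_eq_hasDerivWithinAt_continuousOn
  simp only [zero_sub, zero_add] at hα hαc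
  let f₀ : C(F, F) := ⟨f, hf.continuous⟩
  have hf₀ : ContDiff ℝ ∞ f₀ := hf
  have hΨ := contDiff_integralEquation hf₀
  obtain ⟨e, he⟩ := hasFDerivAt_integralEquation hf₀ x₀ (constCurve x₀)
  let Ψ := hΨ.contDiffAt.toOpenPartialHomeomorph (integralEquation f₀) he (by simp)
  -- `Ψ` is the local inverse from the inverse function theorem; `Ψ.symm (p, 0)` contains the
  -- solution curve with time and initial value `p`, and depends smoothly on `p`.
  have hΨcoe : ∀ q, Ψ q = integralEquation f₀ q := fun q ↦ rfl
  have hΨs : ((0, x₀), constCurve x₀) ∈ Ψ.source :=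
    hΨ.contDiffAt.mem_toOpenPartialHomeomorph_source he (by simp)
  have hΨ0 : Ψ ((0, x₀), constCurve x₀) = ((0, x₀), 0) := by
    simp [hΨcoe, integralEquation]
  -- the inverse is smooth near the base point
  have hinv : ∀ᶠ q in 𝓝 ((0, x₀), (0 : C(unitInterval, F))), ContDiffAt ℝ ∞ Ψ.symm q := by
    -- Smoothness of the inverse at a point needs an invertible derivative there, and invertibility
    -- is an open condition.
    have h1 : ∀ᶠ q in 𝓝 ((0, x₀), constCurve x₀),
        ∃ e' : ((ℝ × F) × C(unitInterval, F)) ≃L[ℝ] ((ℝ × F) × C(unitInterval, F)),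
          HasFDerivAt (integralEquation f₀) (e' : _ →L[ℝ] _) q := by
      have hc : ContinuousAt (fderiv ℝ (integralEquation f₀)) ((0, x₀), constCurve x₀) :=
        (hΨ.continuous_fderiv (by simp)).continuousAt
      have := hc.eventually (by rw [he.fderiv]; exact e.nhds)
      filter_upwards [this] with q ⟨e', he'⟩
      exact ⟨e', by rw [he']; exact (hΨ.differentiable (by simp) q).hasFDerivAt⟩
    have h2 : ContinuousAt Ψ.symm ((0, x₀), 0) := by
      rw [← hΨ0]; exact Ψ.continuousAt_symm (Ψ.map_source hΨs)
    have h3 : Ψ.symm ((0, x₀), 0) = ((0, x₀), constCurve x₀) := by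
      rw [← hΨ0]; exact Ψ.left_inv hΨs
    have ht : ((0, x₀), 0) ∈ Ψ.target := by rw [← hΨ0]; exact Ψ.map_source hΨs
    filter_upwards [h2.eventually (by rw [h3]; exact h1), Ψ.open_target.mem_nhds ht] with q ⟨e', he'⟩ hq
    exact Ψ.contDiffAt_symm hq he' hΨ.contDiffAt
  -- the curves with small parameters lie in the source
  have hnear : ∀ᶠ p : ℝ × F in 𝓝 (0, x₀), p.1 ∈ Set.Ioo (-ε) ε ∧ p.2 ∈ Metric.closedBall x₀ r ∧
      ((p, 0) : (ℝ × F) × C(unitInterval, F)) ∈ {q | ContDiffAt ℝ ∞ Ψ.symm q} ∧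
      α (p.2, p.1) = (Ψ.symm (p, 0)).2 1 := by
    obtain ⟨η, hη, hball⟩ := Metric.isOpen_iff.1 Ψ.open_source _ hΨs
    have hc : ContinuousAt α (x₀, 0) := hαc.continuousAt
      (prod_mem_nhds (Metric.closedBall_mem_nhds x₀ hr) (Icc_mem_nhds (by linarith) hε))
    have hα0 : α (x₀, 0) = x₀ := (hα x₀ (Metric.mem_closedBall_self r.2)).1
    have hev : ∀ᶠ p in 𝓝 (x₀, (0 : ℝ)), dist (α p) x₀ < η / 2 := by
      have := hc.eventually (Metric.ball_mem_nhds (α (x₀, 0)) (half_pos hη))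
      simpa [hα0] using this
    obtain ⟨ρ, hρ, hev⟩ := Metric.eventually_nhds_iff_ball.1 hev
    have hp0 : ContinuousAt (fun p : ℝ × F ↦ (p, (0 : C(unitInterval, F)))) (0, x₀) := by fun_prop
    filter_upwards [prod_mem_nhds (Ioo_mem_nhds (by linarith : -ε < 0) hε)
        (Metric.closedBall_mem_nhds x₀ hr), hp0.eventually hinv,
      Metric.ball_mem_nhds ((0 : ℝ), x₀) (lt_min hρ hη)] with p hp hp1 hp2
    refine ⟨hp.1, hp.2, hp1, ?_⟩
    obtain ⟨T, x⟩ := p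
    simp only [Set.mem_prod] at hp
    rw [Metric.mem_ball, Prod.dist_eq, max_lt_iff, lt_min_iff, lt_min_iff, Real.dist_eq, sub_zero]
      at hp2
    have hTs : ∀ s : unitInterval, |T * s| ≤ |T| := fun s ↦ by
      rw [abs_mul, abs_of_nonneg s.2.1]
      exact mul_le_of_le_one_right (abs_nonneg _) s.2.2
    have hTε : |T| < ε := abs_lt.2 hp.1
    have hIcc : ∀ s ∈ Set.Icc (0 : ℝ) 1, T * s ∈ Set.Ioo (-ε) ε := fun s hs ↦
      abs_lt.1 ((hTs ⟨s, hs⟩).trans_lt hTε)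
    have hder : ∀ s ∈ Set.Icc (0 : ℝ) 1,
        HasDerivAt (fun s ↦ α (x, T * s)) (T • f (α (x, T * s))) s := fun s hs ↦ by
      have h1 := ((hα x hp.2).2 (T * s) (Set.Ioo_subset_Icc_self (hIcc s hs))).hasDerivAt
        (Icc_mem_nhds (hIcc s hs).1 (hIcc s hs).2)
      have h2 : HasDerivAt (fun s : ℝ ↦ T * s) T s := by
        simpa using (hasDerivAt_id s).const_mul T
      exact h1.scomp s h2
    have hcont : ContinuousOn (fun s ↦ α (x, T * s)) (Set.Icc 0 1) :=
      fun s hs ↦ (hder s hs).continuousAt.continuousWithinAt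
    -- The Picard–Lindelöf solution, rescaled to the unit interval. It stays close to `x₀`, hence in
    -- the source of `Ψ`, where injectivity identifies it with the curve in `Ψ.symm ((T, x), 0)`.
    let γ : C(unitInterval, F) := ⟨fun s ↦ α (x, T * s), hcont.domRestrict⟩
    have hγapp : ∀ s : unitInterval, γ s = α (x, T * s) := fun _ ↦ rfl
    have hγball : dist γ (constCurve x₀) < η := by
      refine lt_of_le_of_lt ((ContinuousMap.dist_le (by positivity)).2 fun s ↦ ?_) (half_lt_self hη)
      refine (hev (x, T * s) ?_).le
      rw [Metric.mem_ball, Prod.dist_eq, max_lt_iff, Real.dist_eq, sub_zero]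
      exact ⟨hp2.2.1, (hTs s).trans_lt hp2.1.1⟩
    have hγs : ((T, x), γ) ∈ Ψ.source := by
      refine hball ?_
      rw [Metric.mem_ball, Prod.dist_eq, Prod.dist_eq, max_lt_iff, max_lt_iff, Real.dist_eq, sub_zero]
      exact ⟨⟨hp2.1.2, hp2.2.2⟩, hγball⟩
    have hγeq : Ψ ((T, x), γ) = ((T, x), 0) := by
      rw [hΨcoe]
      refine Prod.ext rfl ?_
      ext s
      have hint : ∫ τ in (0 : ℝ)..s, T • f (α (x, T * τ)) = α (x, T * s) - α (x, T * 0) := by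
        refine intervalIntegral.integral_eq_sub_of_hasDerivAt (f := fun s ↦ α (x, T * s)) ?_ ?_
        · intro τ hτ
          rw [Set.uIcc_of_le s.2.1] at hτ
          exact hder τ ⟨hτ.1, hτ.2.trans s.2.2⟩
        · refine ContinuousOn.intervalIntegrable ?_
          rw [Set.uIcc_of_le s.2.1]
          exact ((hf.continuous.comp_continuousOn hcont).const_smul T).mono
            (Set.Icc_subset_Icc_right s.2.2)
      have hcongr : ∫ τ in (0 : ℝ)..s, Set.IccExtend zero_le_one (f₀.comp γ) τ =
          ∫ τ in (0 : ℝ)..s, f (α (x, T * τ)) := by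
        refine intervalIntegral.integral_congr fun τ hτ ↦ ?_
        rw [Set.uIcc_of_le s.2.1] at hτ
        rw [Set.IccExtend_of_mem _ _ (⟨hτ.1, hτ.2.trans s.2.2⟩ : τ ∈ Set.Icc (0 : ℝ) 1)]
        rfl
      rw [intervalIntegral.integral_smul, mul_zero, (hα x hp.2).1] at hint
      simp only [integralEquation, ContinuousMap.sub_apply, ContinuousMap.add_apply,
        constCurve_apply, ContinuousMap.smul_apply, primitive_apply, hcongr, hint,
        ContinuousMap.zero_apply]
      simp [hγapp]
    have : Ψ.symm ((T, x), 0) = ((T, x), γ) := by rw [← hγeq]; exact Ψ.left_inv hγs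
    rw [this]
    simp [hγapp]
  refine ⟨fun t x ↦ α (x, t), ?_⟩
  filter_upwards [hnear.eventually_nhds] with p hp
  have hp' := hp.self_of_nhds
  refine ⟨(hα p.2 hp'.2.1).1, ((hα p.2 hp'.2.1).2 p.1 (Set.Ioo_subset_Icc_self hp'.1)).hasDerivAt
    (Icc_mem_nhds hp'.1.1 hp'.1.2), ?_⟩
  -- Rescaled time `1` is real time `q.1`, so evaluation at `1` gives the flow.
  have h1 : ContDiffAt ℝ ∞ (fun q : ℝ × F ↦ (Ψ.symm (q, 0)).2 1) p := by
    have h2 : ContDiffAt ℝ ∞ (fun q : ℝ × F ↦ Ψ.symm (q, 0)) p :=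
      ContDiffAt.comp (g := Ψ.symm) (f := fun q : ℝ × F ↦ (q, (0 : C(unitInterval, F)))) p
        hp'.2.2.1 (contDiff_id.prodMk contDiff_const).contDiffAt
    exact (ContinuousMap.evalCLM ℝ (1 : unitInterval)).contDiff.contDiffAt.comp p h2.snd
  exact h1.congr_of_eventuallyEq (hp.mono fun q hq ↦ hq.2.2.2)

/-- The local flow of a vector field that is smooth near a point depends smoothly on time and on the
initial value. -/
theorem exists_smooth_local_flow [FiniteDimensional ℝ F] {f : F → F} {x₀ : F}
    (hf : ∀ᶠ x in 𝓝 x₀, ContDiffAt ℝ ∞ f x) :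
    ∃ φ : ℝ → F → F, ∀ᶠ p : ℝ × F in 𝓝 (0, x₀), φ 0 p.2 = p.2 ∧
      HasDerivAt (φ · p.2) (f (φ p.1 p.2)) p.1 ∧
      ContDiffAt ℝ ∞ (fun q : ℝ × F ↦ φ q.1 q.2) p := by
  obtain ⟨R, hR, hball⟩ := Metric.eventually_nhds_iff_ball.1 hf
  -- A cutoff makes the field globally smooth; for small times the flow stays where the cutoff
  -- equals `1`.
  let b : ContDiffBump x₀ := ⟨R / 4, R / 2, by positivity, by linarith⟩
  have hg : ContDiff ℝ ∞ (fun x ↦ b x • f x) := by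
    rw [contDiff_iff_contDiffAt]
    intro x
    by_cases hx : x ∈ Metric.ball x₀ R
    · exact b.contDiff.contDiffAt.smul (hball x hx)
    · have : x ∉ tsupport b := by
        rw [b.tsupport_eq]
        intro h
        rw [Metric.mem_closedBall] at h
        rw [Metric.mem_ball, not_lt] at hx
        have : b.rOut = R / 2 := rfl
        linarith
      refine (contDiffAt_const (c := (0 : F))).congr_of_eventuallyEq ?_
      filter_upwards [notMem_tsupport_iff_eventuallyEq.1 this] with y hy
      simp [hy]
  obtain ⟨φ, hφ⟩ := exists_smooth_local_flow_of_contDiff hg x₀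
  refine ⟨φ, ?_⟩
  have hcont : ContinuousAt (fun q : ℝ × F ↦ φ q.1 q.2) (0, x₀) := hφ.self_of_nhds.2.2.continuousAt
  have h1 : ∀ᶠ x in 𝓝 (φ 0 x₀), b x = 1 := by
    rw [hφ.self_of_nhds.1]; exact b.eventuallyEq_one
  filter_upwards [hφ, hcont.eventually h1] with p hp hp1
  refine ⟨hp.1, ?_, hp.2.2⟩
  simpa [hp1] using hp.2.1

end LocalFlow
end StefanSussmann

namespace StefanSussmann

/-! ### Velocities of curves in manifolds -/

section Curves

variable {E : Type v} [NormedAddCommGroup E] [NormedSpace ℝ E]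
  {M : Type u} [TopologicalSpace M] [ChartedSpace E M]
  {E' : Type*} [NormedAddCommGroup E'] [NormedSpace ℝ E']
  {M' : Type*} [TopologicalSpace M'] [ChartedSpace E' M']

/-- A curve `γ` in a manifold has velocity `v` at time `t`. -/
def HasVelocityAt (γ : ℝ → M) (t : ℝ) (v : TangentSpace 𝓘(ℝ, E) (γ t)) : Prop :=
  HasMFDerivAt 𝓘(ℝ, ℝ) 𝓘(ℝ, E) γ t ((1 : ℝ →L[ℝ] ℝ).smulRight v)

theorem HasVelocityAt.comp {γ : ℝ → M'} {t : ℝ} {v : TangentSpace 𝓘(ℝ, E') (γ t)}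
    (hγ : HasVelocityAt γ t v) {f : M' → M} (hf : MDifferentiableAt 𝓘(ℝ, E') 𝓘(ℝ, E) f (γ t)) :
    HasVelocityAt (f ∘ γ) t (mfderiv 𝓘(ℝ, E') 𝓘(ℝ, E) f (γ t) v) := by
  have h := HasMFDerivAt.comp t hf.hasMFDerivAt hγ
  have h2 : (mfderiv 𝓘(ℝ, E') 𝓘(ℝ, E) f (γ t)).comp ((1 : ℝ →L[ℝ] ℝ).smulRight v) =
      (1 : ℝ →L[ℝ] ℝ).smulRight (mfderiv 𝓘(ℝ, E') 𝓘(ℝ, E) f (γ t) v) := by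
    ext; simp
  unfold HasVelocityAt
  rw [← h2]
  exact h

/-- Used with `f` an inverse chart, to carry integral curves of the chart representation back to the
manifold. -/
theorem HasVelocityAt.comp_of_mpullback {γ : ℝ → M'} {t : ℝ} {f : M' → M}
    {V : (x : M) → TangentSpace 𝓘(ℝ, E) x}
    (hγ : HasVelocityAt γ t (VectorField.mpullback 𝓘(ℝ, E') 𝓘(ℝ, E) f V (γ t)))
    (hf : MDifferentiableAt 𝓘(ℝ, E') 𝓘(ℝ, E) f (γ t))
    (hf' : (mfderiv 𝓘(ℝ, E') 𝓘(ℝ, E) f (γ t)).IsInvertible) :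
    HasVelocityAt (f ∘ γ) t (V (f (γ t))) := by
  have h := hγ.comp hf
  rwa [VectorField.mpullback_apply, hf'.self_apply_inverse] at h

theorem HasVelocityAt.congr_of_eventuallyEq {γ γ' : ℝ → M} {t : ℝ}
    {v : (x : M) → TangentSpace 𝓘(ℝ, E) x} (h : HasVelocityAt γ t (v (γ t)))
    (h' : γ' =ᶠ[𝓝 t] γ) : HasVelocityAt γ' t (v (γ' t)) := by
  unfold HasVelocityAt at *
  rw [h'.self_of_nhds]
  exact HasMFDerivAt.congr_of_eventuallyEq h h'

theorem HasVelocityAt.continuousAt {γ : ℝ → M} {t : ℝ} {v : TangentSpace 𝓘(ℝ, E) (γ t)}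
    (h : HasVelocityAt γ t v) : ContinuousAt γ t :=
  HasMFDerivAt.continuousAt h

theorem HasDerivAt.hasVelocityAt {γ : ℝ → E} {t : ℝ} {v : E} (h : HasDerivAt γ v t) :
    HasVelocityAt (M := E) γ t v :=
  (hasMFDerivAt_iff_hasFDerivAt.2 h.hasFDerivAt : HasMFDerivAt 𝓘(ℝ, ℝ) 𝓘(ℝ, E) γ t _)

theorem isMIntegralCurveOn_iff_hasVelocityAt {γ : ℝ → M} {v : (x : M) → TangentSpace 𝓘(ℝ, E) x}
    {s : Set ℝ} (hs : IsOpen s) :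
    IsMIntegralCurveOn (I := 𝓘(ℝ, E)) γ v s ↔ ∀ t ∈ s, HasVelocityAt γ t (v (γ t)) :=
  forall₂_congr fun _ ht ↦ ⟨fun h ↦ h.hasMFDerivAt (hs.mem_nhds ht), fun h ↦ HasMFDerivAt.hasMFDerivWithinAt h⟩

end Curves

section
variable {E : Type v} [NormedAddCommGroup E] [NormedSpace ℝ E]
variable {M : Type u} [TopologicalSpace M] [ChartedSpace E M] [IsManifold 𝓘(ℝ, E) ∞ M]

/-! ### Local flows on the manifold, through charts -/

namespace LocalVectorField

theorem contMDiffAt (X : LocalVectorField E M) {x : M} (hx : x ∈ X.domain) :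
    ContMDiffAt 𝓘(ℝ, E) 𝓘(ℝ, E).tangent ∞
      (fun x ↦ (⟨x, X.toFun x⟩ : TangentBundle 𝓘(ℝ, E) M)) x :=
  X.smooth.contMDiffAt (X.isOpen_domain.mem_nhds hx)

/-- Representation of a local vector field in a chart. -/
noncomputable def inChart (X : LocalVectorField E M) (x₀ : M) : E → E :=
  VectorField.mpullback 𝓘(ℝ, E) 𝓘(ℝ, E) (extChartAt 𝓘(ℝ, E) x₀).symm X.toFun

theorem isInvertible_mfderiv_extChartAt_symm {x₀ : M} {y : E}
    (hy : y ∈ (extChartAt 𝓘(ℝ, E) x₀).target) :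
    (mfderiv 𝓘(ℝ, E) 𝓘(ℝ, E) (extChartAt 𝓘(ℝ, E) x₀).symm y).IsInvertible := by
  have := isInvertible_mfderivWithin_extChartAt_symm (I := 𝓘(ℝ, E)) hy
  simpa [mfderivWithin_univ] using this

theorem contMDiffAt_extChartAt_symm {x₀ : M} {y : E}
    (hy : y ∈ (extChartAt 𝓘(ℝ, E) x₀).target) :
    ContMDiffAt 𝓘(ℝ, E) 𝓘(ℝ, E) ∞ (extChartAt 𝓘(ℝ, E) x₀).symm y :=
  (contMDiffOn_extChartAt_symm x₀).contMDiffAt ((isOpen_extChartAt_target x₀).mem_nhds hy)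

variable [FiniteDimensional ℝ E]

theorem contDiffAt_inChart (X : LocalVectorField E M) {x₀ : M} {y : E}
    (hy : y ∈ (extChartAt 𝓘(ℝ, E) x₀).target)
    (hX : (extChartAt 𝓘(ℝ, E) x₀).symm y ∈ X.domain) : ContDiffAt ℝ ∞ (X.inChart x₀) y := by
  have h := ContMDiffAt.mpullback_vectorField_preimage (X.contMDiffAt hX)
    (contMDiffAt_extChartAt_symm hy) (isInvertible_mfderiv_extChartAt_symm hy)
    (by simp)
  rw [← contMDiffAt_iff_contDiffAt]
  exact ((contMDiff_snd_tangentBundle_modelSpace E 𝓘(ℝ, E)).contMDiffAt).comp y h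

/-- The local flow of `X` near a point of its domain. -/
theorem exists_smooth_flow_near (X : LocalVectorField E M) {x₀ : M} (hx₀ : x₀ ∈ X.domain) :
    ∃ Φ : ℝ → M → M, ∀ᶠ p : ℝ × M in 𝓝 (0, x₀), Φ 0 p.2 = p.2 ∧ Φ p.1 p.2 ∈ X.domain ∧
      HasVelocityAt (Φ · p.2) p.1 (X.toFun (Φ p.1 p.2)) ∧
      ContMDiffAt (𝓘(ℝ, ℝ).prod 𝓘(ℝ, E)) 𝓘(ℝ, E) ∞ (fun q : ℝ × M ↦ Φ q.1 q.2) p := by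
  set e := extChartAt 𝓘(ℝ, E) x₀ with he
  have hcs : ContinuousAt e.symm (e x₀) := continuousAt_extChartAt_symm x₀
  have hes : e.symm (e x₀) = x₀ := extChartAt_to_inv x₀
  have hdom : ∀ᶠ y in 𝓝 (e x₀), y ∈ e.target ∧ e.symm y ∈ X.domain :=
    (show ∀ᶠ y in 𝓝 (e x₀), y ∈ e.target from extChartAt_target_mem_nhds x₀).and
      (hcs.eventually (by rw [hes]; exact X.isOpen_domain.mem_nhds hx₀))
  obtain ⟨φ, hφ⟩ := exists_smooth_local_flow (f := X.inChart x₀) (x₀ := e x₀)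
    (hdom.mono fun y hy ↦ X.contDiffAt_inChart hy.1 hy.2)
  refine ⟨fun t x ↦ e.symm (φ t (e x)), ?_⟩
  have hφc : ContinuousAt (fun q : ℝ × E ↦ φ q.1 q.2) (0, e x₀) :=
    hφ.self_of_nhds.2.2.continuousAt
  have hφ2 : ∀ᶠ p : ℝ × E in 𝓝 (0, e x₀), φ p.1 p.2 ∈ e.target ∧ e.symm (φ p.1 p.2) ∈ X.domain :=
    hφc.eventually (by simp only [hφ.self_of_nhds.1]; exact hdom)
  have hmap : ContinuousAt (fun p : ℝ × M ↦ (p.1, e p.2)) (0, x₀) :=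
    continuousAt_fst.prodMk (ContinuousAt.comp (g := e) (f := Prod.snd) (x := ((0 : ℝ), x₀))
      (continuousAt_extChartAt x₀) continuousAt_snd)
  have hsrc : ∀ᶠ p : ℝ × M in 𝓝 (0, x₀), p.2 ∈ (chartAt E x₀).source :=
    continuousAt_snd.eventually ((chartAt E x₀).open_source.mem_nhds (mem_chart_source E x₀))
  filter_upwards [hmap.eventually hφ, hmap.eventually hφ2, hsrc] with p hp hp2 hps
  have hps' : p.2 ∈ e.source := by rwa [he, extChartAt_source]
  refine ⟨by simp only [hp.1]; exact e.left_inv hps', hp2.2, ?_, ?_⟩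
  · exact HasVelocityAt.comp_of_mpullback (f := e.symm) (V := X.toFun)
      (HasDerivAt.hasVelocityAt hp.2.1)
      ((contMDiffAt_extChartAt_symm hp2.1).mdifferentiableAt (by simp))
      (isInvertible_mfderiv_extChartAt_symm hp2.1)
  · have h1 : ContMDiffAt (𝓘(ℝ, ℝ).prod 𝓘(ℝ, E)) 𝓘(ℝ, E) ∞ (fun q : ℝ × M ↦ e q.2) p :=
      (contMDiffAt_extChartAt' hps).comp p contMDiffAt_snd
    have h2 : ContMDiffAt (𝓘(ℝ, ℝ).prod 𝓘(ℝ, E)) 𝓘(ℝ, ℝ × E) ∞ (fun q : ℝ × M ↦ (q.1, e q.2)) p :=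
      contMDiffAt_fst.prodMk_space h1
    have h3 := (hp.2.2.contMDiffAt).comp p h2
    exact (contMDiffAt_extChartAt_symm hp2.1).comp p h3

end LocalVectorField
end
end StefanSussmann

/-! ### The maximal flow: uniqueness, group law, smoothness and pullbacks -/

namespace StefanSussmann
namespace LocalVectorField

variable {E : Type v} [NormedAddCommGroup E] [NormedSpace ℝ E]
variable {M : Type u} [TopologicalSpace M] [ChartedSpace E M] [IsManifold 𝓘(ℝ, E) ∞ M]

/-- `γ` is an integral curve of `X` on the open interval from `a` to `b`. -/
def IsFlowCurve (X : LocalVectorField E M) (γ : ℝ → M) (a b : ℝ) : Prop :=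
  ∀ s ∈ Set.Ioo a b, γ s ∈ X.domain ∧ HasVelocityAt γ s (X.toFun (γ s))

variable {X Y Z : LocalVectorField E M} {γ γ' : ℝ → M} {a b c d s t : ℝ} {x y z : M}

theorem IsFlowCurve.mono (h : X.IsFlowCurve γ a b) (hac : a ≤ c) (hdb : d ≤ b) :
    X.IsFlowCurve γ c d :=
  fun s hs ↦ h s ⟨hac.trans_lt hs.1, hs.2.trans_le hdb⟩

theorem IsFlowCurve.isMIntegralCurveOn (h : X.IsFlowCurve γ a b) :
    IsMIntegralCurveOn (I := 𝓘(ℝ, E)) γ X.toFun (Set.Ioo a b) :=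
  (isMIntegralCurveOn_iff_hasVelocityAt isOpen_Ioo).2 fun s hs ↦ (h s hs).2

theorem flowsTo_iff : X.FlowsTo t x y ↔ ∃ (γ : ℝ → M) (a b : ℝ), (0 : ℝ) ∈ Set.Ioo a b ∧
    t ∈ Set.Ioo a b ∧ γ 0 = x ∧ γ t = y ∧ X.IsFlowCurve γ a b := by
  constructor
  · rintro ⟨γ, a, b, h0, ht, hx, hy, hd, hi⟩
    exact ⟨γ, a, b, h0, ht, hx, hy, fun s hs ↦
      ⟨hd s hs, (isMIntegralCurveOn_iff_hasVelocityAt isOpen_Ioo).1 hi s hs⟩⟩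
  · rintro ⟨γ, a, b, h0, ht, hx, hy, h⟩
    exact ⟨γ, a, b, h0, ht, hx, hy, fun s hs ↦ (h s hs).1, h.isMIntegralCurveOn⟩

theorem IsFlowCurve.comp_add (h : X.IsFlowCurve γ a b) (r : ℝ) :
    X.IsFlowCurve (fun s ↦ γ (s + r)) (a - r) (b - r) := by
  have h1 := h.isMIntegralCurveOn.comp_add r
  have h2 : {t | t + r ∈ Set.Ioo a b} = Set.Ioo (a - r) (b - r) := by
    ext t; simp [sub_lt_iff_lt_add, lt_sub_iff_add_lt]
  rw [h2] at h1
  intro s hs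
  exact ⟨(h (s + r) ⟨by linarith [hs.1], by linarith [hs.2]⟩).1,
    (isMIntegralCurveOn_iff_hasVelocityAt isOpen_Ioo).1 h1 s hs⟩

theorem IsFlowCurve.flowsTo (h : X.IsFlowCurve γ a b) (hs : s ∈ Set.Ioo a b)
    (ht : t ∈ Set.Ioo a b) : X.FlowsTo (t - s) (γ s) (γ t) := by
  refine flowsTo_iff.2 ⟨fun r ↦ γ (r + s), a - s, b - s, ?_, ?_, by simp, by simp, h.comp_add s⟩
  · simpa using hs
  · simpa using ht

theorem FlowsTo.symm (hf : X.FlowsTo t x y) : X.FlowsTo (-t) y x := by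
  obtain ⟨γ, a, b, h0, ht, rfl, rfl, h⟩ := flowsTo_iff.1 hf
  simpa using h.flowsTo ht h0

theorem flowDomain_subset_domain : X.flowDomain t ⊆ X.domain := by
  rintro x ⟨y, γ, a, b, h0, -, rfl, -, hd, -⟩
  exact hd 0 h0

/-- The flow is defined near `(t, x)` and smooth at `(t, x)`. -/
def FlowSmoothAt (X : LocalVectorField E M) (p : ℝ × M) : Prop :=
  (∀ᶠ q in 𝓝 p, q.2 ∈ X.flowDomain q.1) ∧
    ContMDiffAt (𝓘(ℝ, ℝ).prod 𝓘(ℝ, E)) 𝓘(ℝ, E) ∞ (fun q : ℝ × M ↦ X.flow q.1 q.2) p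

theorem FlowSmoothAt.mem (h : X.FlowSmoothAt (t, x)) : x ∈ X.flowDomain t := h.1.self_of_nhds

theorem FlowSmoothAt.contMDiffAt (h : X.FlowSmoothAt (t, x)) :
    ContMDiffAt 𝓘(ℝ, E) 𝓘(ℝ, E) ∞ (X.flow t) x :=
  h.2.comp (f := fun y : M ↦ (t, y)) x (contMDiffAt_const.prodMk contMDiffAt_id)

theorem FlowSmoothAt.eventually_mem (h : X.FlowSmoothAt (t, x)) :
    ∀ᶠ y in 𝓝 x, y ∈ X.flowDomain t :=
  (show ContinuousAt (fun y : M ↦ (t, y)) x by fun_prop).eventually h.1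

theorem IsFlowPullback.unique {Z Z' : LocalVectorField E M} (h : X.IsFlowPullback t Y Z)
    (h' : X.IsFlowPullback t Y Z') : Z = Z' := by
  have hd : Z.domain = Z'.domain := h.1.trans h'.1.symm
  refine LocalVectorField.ext hd (funext fun x ↦ ?_)
  by_cases hx : x ∈ Z.domain
  · rw [h.2 x hx, h'.2 x (hd ▸ hx)]
  · rw [Z.zero_outside x hx, Z'.zero_outside x (hd ▸ hx)]

variable [T2Space M]

/-- Agreement is an open condition by local uniqueness of integral curves and a closed one because
`M` is Hausdorff; the interval is connected. -/
theorem IsFlowCurve.eqOn (h : X.IsFlowCurve γ a b) (h' : X.IsFlowCurve γ' a b)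
    (hs : s ∈ Set.Ioo a b) (heq : γ s = γ' s) : Set.EqOn γ γ' (Set.Ioo a b) := by
  intro t ht
  refine isPreconnected_Ioo.induction₂' (fun s t ↦ γ s = γ' s → γ t = γ' t) ?_
    (fun _ _ _ _ _ _ h1 h2 ↦ h2 ∘ h1) hs ht heq
  intro r hr
  refine Filter.Eventually.filter_mono nhdsWithin_le_nhds ?_
  by_cases hreq : γ r = γ' r
  · have hnhds := Ioo_mem_nhds hr.1 hr.2
    filter_upwards [isMIntegralCurveAt_eventuallyEq_of_contMDiffAt_boundaryless
      ((X.contMDiffAt (h r hr).1).of_le (by simp))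
      (h.isMIntegralCurveOn.isMIntegralCurveAt hnhds)
      (h'.isMIntegralCurveOn.isMIntegralCurveAt hnhds) hreq] with q hq
    exact ⟨fun _ ↦ hq, fun _ ↦ hreq⟩
  · filter_upwards [((h r hr).2.continuousAt.prodMk (h' r hr).2.continuousAt).eventually
      (isClosed_diagonal.isOpen_compl.mem_nhds hreq)] with q hq
    exact ⟨fun h ↦ absurd h hreq, fun h ↦ absurd h hq⟩

open Classical in
theorem IsFlowCurve.glue (h : X.IsFlowCurve γ a b) (h' : X.IsFlowCurve γ' c d)
    (hs : s ∈ Set.Ioo a b) (hs' : s ∈ Set.Ioo c d) (heq : γ s = γ' s) :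
    X.IsFlowCurve (fun r ↦ if r ∈ Set.Ioo a b then γ r else γ' r) (min a c) (max b d) ∧
    ∀ r ∈ Set.Ioo c d, (if r ∈ Set.Ioo a b then γ r else γ' r) = γ' r := by
  have hov : ∀ r ∈ Set.Ioo c d, (if r ∈ Set.Ioo a b then γ r else γ' r) = γ' r := by
    intro r hr
    split_ifs with hr'
    · exact (h.mono (le_max_left a c) (min_le_left b d)).eqOn
        (h'.mono (le_max_right a c) (min_le_right b d))
        ⟨max_lt hs.1 hs'.1, lt_min hs.2 hs'.2⟩ heq ⟨max_lt hr'.1 hr.1, lt_min hr'.2 hr.2⟩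
    · rfl
  refine ⟨fun r hr ↦ ?_, hov⟩
  by_cases hr' : r ∈ Set.Ioo a b
  · have hev : (fun r ↦ if r ∈ Set.Ioo a b then γ r else γ' r) =ᶠ[𝓝 r] γ := by
      filter_upwards [Ioo_mem_nhds hr'.1 hr'.2] with q hq
      simp only [if_pos hq]
    refine ⟨?_, (h r hr').2.congr_of_eventuallyEq hev⟩
    simp only [if_pos hr']
    exact (h r hr').1
  -- Both intervals contain `s`, so their union is the whole interval from `min a c` to `max b d`.
  · have hr2 : r ∈ Set.Ioo c d := by
      simp only [Set.mem_Ioo, min_lt_iff, lt_max_iff, not_and_or, not_lt] at *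
      grind
    have hev : (fun r ↦ if r ∈ Set.Ioo a b then γ r else γ' r) =ᶠ[𝓝 r] γ' := by
      filter_upwards [Ioo_mem_nhds hr2.1 hr2.2] with q hq
      exact hov q hq
    refine ⟨?_, (h' r hr2).2.congr_of_eventuallyEq hev⟩
    simp only [if_neg hr']
    exact (h' r hr2).1

theorem FlowsTo.unique (hf : X.FlowsTo t x y) (hf' : X.FlowsTo t x z) : y = z := by
  obtain ⟨γ, a, b, h0, ht, hx, rfl, h⟩ := flowsTo_iff.1 hf
  obtain ⟨γ', c, d, h0', ht', hx', rfl, h'⟩ := flowsTo_iff.1 hf'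
  exact (h.mono (le_max_left a c) (min_le_left b d)).eqOn
        (h'.mono (le_max_right a c) (min_le_right b d))
        ⟨max_lt h0.1 h0'.1, lt_min h0.2 h0'.2⟩ (hx.trans hx'.symm)
        ⟨max_lt ht.1 ht'.1, lt_min ht.2 ht'.2⟩

theorem FlowsTo.trans (hf : X.FlowsTo s x y) (hf' : X.FlowsTo t y z) : X.FlowsTo (s + t) x z := by
  classical
  obtain ⟨γ, a, b, h0, hs, rfl, rfl, h⟩ := flowsTo_iff.1 hf
  obtain ⟨γ', c, d, h0', ht', hx', rfl, h'⟩ := flowsTo_iff.1 hf'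
  have h2 := h'.comp_add (-s)
  obtain ⟨h3, h4⟩ := h.glue h2 hs (by simpa using h0') (by simpa using hx'.symm)
  refine flowsTo_iff.2 ⟨_, _, _, ?_, ?_, ?_, ?_, h3⟩
  · exact ⟨(min_le_left _ _).trans_lt h0.1, h0.2.trans_le (le_max_left _ _)⟩
  · refine ⟨(min_le_right _ _).trans_lt ?_, lt_of_lt_of_le ?_ (le_max_right _ _)⟩
    · linarith [ht'.1]
    · linarith [ht'.2]
  · simp only [if_pos h0]
  · rw [h4 (s + t) ⟨by linarith [ht'.1], by linarith [ht'.2]⟩]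
    congr 1
    ring

theorem FlowsTo.flow_eq (h : X.FlowsTo t x y) : X.flow t x = y := by
  have hex : ∃ y, X.FlowsTo t x y := ⟨y, h⟩
  rw [flow, dif_pos hex]
  exact hex.choose_spec.unique h

theorem flowsTo_flow (h : x ∈ X.flowDomain t) : X.FlowsTo t x (X.flow t x) := by
  obtain ⟨y, hy⟩ := h
  rwa [hy.flow_eq]

theorem flow_mem_flowDomain_neg (h : x ∈ X.flowDomain t) : X.flow t x ∈ X.flowDomain (-t) :=
  ⟨x, (flowsTo_flow h).symm⟩

theorem flow_neg_flow (h : x ∈ X.flowDomain t) : X.flow (-t) (X.flow t x) = x :=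
  (flowsTo_flow h).symm.flow_eq

theorem flow_mem_domain (h : x ∈ X.flowDomain t) : X.flow t x ∈ X.domain :=
  flowDomain_subset_domain (flow_mem_flowDomain_neg h)

/-- The curve given by the flow has the velocity prescribed by the vector field. -/
theorem hasVelocityAt_flow (h : x ∈ X.flowDomain t) :
    HasVelocityAt (fun s ↦ X.flow s x) t (X.toFun (X.flow t x)) := by
  obtain ⟨y, hy⟩ := h
  obtain ⟨γ, a, b, h0, ht, rfl, rfl, h⟩ := flowsTo_iff.1 hy
  refine (h t ht).2.congr_of_eventuallyEq ?_
  filter_upwards [Ioo_mem_nhds ht.1 ht.2] with s hs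
  have := h.flowsTo h0 hs
  rw [sub_zero] at this
  exact this.flow_eq

/-- Near `(s + t, x)` the flow factors as the map at the frozen time `s`, followed by the flow for
the remaining time `q.1 - s`, which varies near `t`. -/
theorem FlowSmoothAt.trans (h : X.FlowSmoothAt (s, x))
    (h' : X.FlowSmoothAt (t, X.flow s x)) : X.FlowSmoothAt (s + t, x) := by
  have hmap : ContMDiffAt (𝓘(ℝ, ℝ).prod 𝓘(ℝ, E)) (𝓘(ℝ, ℝ).prod 𝓘(ℝ, E)) ∞
      (fun q : ℝ × M ↦ (q.1 - s, X.flow s q.2)) (s + t, x) := by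
    refine ContMDiffAt.prodMk ?_ ?_
    · have h1 : ContMDiff 𝓘(ℝ, ℝ) 𝓘(ℝ, ℝ) ∞ (fun r : ℝ ↦ r - s) :=
        (contDiff_id.sub contDiff_const).contMDiff
      exact h1.contMDiffAt.comp (f := Prod.fst) (s + t, x) contMDiffAt_fst
    · exact ContMDiffAt.comp (g := X.flow s) (f := Prod.snd) (s + t, x) h.contMDiffAt contMDiffAt_snd
  have hmap0 : (fun q : ℝ × M ↦ (q.1 - s, X.flow s q.2)) (s + t, x) = (t, X.flow s x) := by simp
  have hev : ∀ᶠ q : ℝ × M in 𝓝 (s + t, x), X.FlowsTo q.1 q.2 (X.flow (q.1 - s) (X.flow s q.2)) := by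
    have h1 := hmap.continuousAt.eventually (by rw [hmap0]; exact h'.1)
    have h2 : ∀ᶠ q : ℝ × M in 𝓝 (s + t, x), q.2 ∈ X.flowDomain s :=
      continuousAt_snd.eventually h.eventually_mem
    filter_upwards [h1, h2] with q hq1 hq2
    have := (flowsTo_flow hq2).trans (flowsTo_flow hq1)
    simpa using this
  refine ⟨hev.mono fun q hq ↦ ⟨_, hq⟩, ?_⟩
  refine ContMDiffAt.congr_of_eventuallyEq ?_ (hev.mono fun q hq ↦ hq.flow_eq)
  exact ContMDiffAt.comp_of_eq (g := fun q : ℝ × M ↦ X.flow q.1 q.2) h'.2 hmap hmap0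

variable [FiniteDimensional ℝ E]

theorem eventually_flowSmoothAt {x₀ : M} (hx₀ : x₀ ∈ X.domain) :
    ∀ᶠ p : ℝ × M in 𝓝 (0, x₀), X.FlowSmoothAt p := by
  obtain ⟨Φ, hΦ⟩ := X.exists_smooth_flow_near hx₀
  obtain ⟨A, hA, B, hB, hAB⟩ := mem_nhds_prod_iff.1 hΦ
  obtain ⟨δ, hδ, hδA⟩ := Metric.mem_nhds_iff.1 hA
  rw [Real.ball_eq_Ioo, zero_sub, zero_add] at hδA
  have key : ∀ᶠ q : ℝ × M in 𝓝 (0, x₀), X.FlowsTo q.1 q.2 (Φ q.1 q.2) := by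
    filter_upwards [prod_mem_nhds (Ioo_mem_nhds (neg_lt_zero.2 hδ) hδ) hB] with q hq
    have h0 : (0 : ℝ) ∈ Set.Ioo (-δ) δ := ⟨neg_lt_zero.2 hδ, hδ⟩
    refine flowsTo_iff.2 ⟨(Φ · q.2), -δ, δ, h0, hq.1, ?_, rfl, fun s hs ↦ ?_⟩
    · exact (hAB (Set.mk_mem_prod (hδA h0) hq.2)).1
    · have := hAB (Set.mk_mem_prod (hδA hs) hq.2)
      exact ⟨this.2.1, this.2.2.1⟩
  filter_upwards [hΦ, key.eventually_nhds] with p hp hkey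
  exact ⟨hkey.mono fun q hq ↦ ⟨_, hq⟩,
    hp.2.2.2.congr_of_eventuallyEq (hkey.mono fun q hq ↦ hq.flow_eq)⟩

/-- The maximal flow has an open domain and is smooth on it. -/
theorem flowSmoothAt (h : x ∈ X.flowDomain t) : X.FlowSmoothAt (t, x) := by
  obtain ⟨y, hy⟩ := h
  obtain ⟨γ, a, b, h0, ht, rfl, rfl, h⟩ := flowsTo_iff.1 hy
  have hflow : ∀ s ∈ Set.Ioo a b, X.flow s (γ 0) = γ s := fun s hs ↦ by
    simpa using (h.flowsTo h0 hs).flow_eq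
  -- Smoothness propagates along the trajectory: between nearby times `s` and `r` one passes by a
  -- short flow, smooth by `eventually_flowSmoothAt`. The induction needs both directions, forward
  -- from `γ s` and back from `γ r`.
  refine isPreconnected_Ioo.induction₂'
    (fun s t ↦ X.FlowSmoothAt (s, γ 0) → X.FlowSmoothAt (t, γ 0)) ?_
    (fun _ _ _ _ _ _ h1 h2 ↦ h2 ∘ h1) h0 ht
    (eventually_flowSmoothAt (h 0 h0).1).self_of_nhds
  intro s hs
  have hev := eventually_flowSmoothAt (h s hs).1
  have hc := (h s hs).2.continuousAt
  have h1 : ∀ᶠ r in 𝓝 s, X.FlowSmoothAt (r - s, γ s) := by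
    have : ContinuousAt (fun r ↦ (r - s, γ s)) s := by fun_prop
    exact this.eventually (by simpa using hev)
  have h2 : ∀ᶠ r in 𝓝 s, X.FlowSmoothAt (s - r, γ r) := by
    have : ContinuousAt (fun r ↦ (s - r, γ r)) s :=
      (show ContinuousAt (fun r ↦ s - r) s by fun_prop).prodMk hc
    exact this.eventually (by simpa using hev)
  filter_upwards [self_mem_nhdsWithin, nhdsWithin_le_nhds h1, nhdsWithin_le_nhds h2] with r hr hr1 hr2
  constructor
  · intro hG
    have := hG.trans (t := r - s) (by rwa [hflow s hs])
    simpa using this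
  · intro hG
    have := hG.trans (t := s - r) (by rwa [hflow r hr])
    simpa using this

theorem isOpen_flowDomain (X : LocalVectorField E M) (t : ℝ) : IsOpen (X.flowDomain t) :=
  isOpen_iff_mem_nhds.2 fun _ hx ↦ (flowSmoothAt hx).eventually_mem

theorem contMDiffAt_flow (h : x ∈ X.flowDomain t) :
    ContMDiffAt 𝓘(ℝ, E) 𝓘(ℝ, E) ∞ (X.flow t) x :=
  (flowSmoothAt h).contMDiffAt

theorem mdifferentiableAt_flow (h : x ∈ X.flowDomain t) :
    MDifferentiableAt 𝓘(ℝ, E) 𝓘(ℝ, E) (X.flow t) x :=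
  (contMDiffAt_flow h).mdifferentiableAt (by simp)

theorem mfderiv_flow_neg_comp (h : x ∈ X.flowDomain t) :
    (mfderiv 𝓘(ℝ, E) 𝓘(ℝ, E) (X.flow (-t)) (X.flow t x)).comp
      (mfderiv 𝓘(ℝ, E) 𝓘(ℝ, E) (X.flow t) x) = ContinuousLinearMap.id ℝ E := by
  have h1 := HasMFDerivAt.comp x
    (mdifferentiableAt_flow (flow_mem_flowDomain_neg h)).hasMFDerivAt
    (mdifferentiableAt_flow h).hasMFDerivAt
  have h2 : HasMFDerivAt 𝓘(ℝ, E) 𝓘(ℝ, E) (X.flow (-t) ∘ X.flow t) x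
      (ContinuousLinearMap.id ℝ (TangentSpace 𝓘(ℝ, E) x)) := by
    refine (hasMFDerivAt_id x).congr_of_eventuallyEq ?_
    filter_upwards [(X.isOpen_flowDomain t).mem_nhds h] with y hy
    exact flow_neg_flow hy
  exact hasMFDerivAt_unique h1 h2

theorem mfderiv_flow_neg_apply (h : x ∈ X.flowDomain t) (w : TangentSpace 𝓘(ℝ, E) x) :
    mfderiv 𝓘(ℝ, E) 𝓘(ℝ, E) (X.flow (-t)) (X.flow t x)
      (mfderiv 𝓘(ℝ, E) 𝓘(ℝ, E) (X.flow t) x w) = w :=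
  DFunLike.congr_fun (mfderiv_flow_neg_comp h) w

theorem mfderiv_flow_apply_neg (h : x ∈ X.flowDomain t)
    (w : TangentSpace 𝓘(ℝ, E) (X.flow t x)) :
    mfderiv 𝓘(ℝ, E) 𝓘(ℝ, E) (X.flow t) x
      (mfderiv 𝓘(ℝ, E) 𝓘(ℝ, E) (X.flow (-t)) (X.flow t x) w) = w := by
  have h1 := mfderiv_flow_neg_apply (flow_mem_flowDomain_neg h) w
  rwa [neg_neg, flow_neg_flow h] at h1

theorem isInvertible_mfderiv_flow (h : x ∈ X.flowDomain t) :
    (mfderiv 𝓘(ℝ, E) 𝓘(ℝ, E) (X.flow t) x).IsInvertible :=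
  ContinuousLinearMap.IsInvertible.of_inverse
    (g := (mfderiv 𝓘(ℝ, E) 𝓘(ℝ, E) (X.flow (-t)) (X.flow t x) : E →L[ℝ] E))
    (ContinuousLinearMap.ext fun w ↦ mfderiv_flow_apply_neg h w) (mfderiv_flow_neg_comp h)

theorem inverse_mfderiv_flow_apply (h : x ∈ X.flowDomain t)
    (w : TangentSpace 𝓘(ℝ, E) (X.flow t x)) :
    (mfderiv 𝓘(ℝ, E) 𝓘(ℝ, E) (X.flow t) x).inverse w =
      mfderiv 𝓘(ℝ, E) 𝓘(ℝ, E) (X.flow (-t)) (X.flow t x) w := by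
  exact (isInvertible_mfderiv_flow h).injective
    (((isInvertible_mfderiv_flow h).self_apply_inverse w).trans (mfderiv_flow_apply_neg h w).symm)

/-- The pullback of a local vector field along a flow exists. -/
theorem exists_isFlowPullback (X : LocalVectorField E M) (t : ℝ) (Y : LocalVectorField E M) :
    ∃ Z, X.IsFlowPullback t Y Z := by
  classical
  let D : Set M := {x | x ∈ X.flowDomain t ∧ X.flow t x ∈ Y.domain}
  have hD : IsOpen D := isOpen_iff_mem_nhds.2 fun x hx ↦
    Filter.inter_mem ((X.isOpen_flowDomain t).mem_nhds hx.1)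
      ((contMDiffAt_flow hx.1).continuousAt.eventually (Y.isOpen_domain.mem_nhds hx.2))
  let V := VectorField.mpullback 𝓘(ℝ, E) 𝓘(ℝ, E) (X.flow t) Y.toFun
  refine ⟨⟨D, fun x ↦ if x ∈ D then V x else 0, hD, fun x hx ↦ ?_, fun x hx ↦ if_neg hx⟩, rfl,
    fun x hx ↦ if_pos hx⟩
  have h := ContMDiffAt.mpullback_vectorField_preimage (Y.contMDiffAt hx.2)
    (contMDiffAt_flow hx.1) (isInvertible_mfderiv_flow hx.1) (by simp)
  refine ContMDiffAt.contMDiffWithinAt (h.congr_of_eventuallyEq ?_)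
  filter_upwards [hD.mem_nhds hx] with y hy
  simp only [if_pos hy]
  rfl

end LocalVectorField
end StefanSussmann

/-! ### Stable sets and infinitesimal automorphisms -/

namespace StefanSussmann

variable {E : Type v} [NormedAddCommGroup E] [NormedSpace ℝ E]
variable {M : Type u} [TopologicalSpace M] [ChartedSpace E M] [IsManifold 𝓘(ℝ, E) ∞ M]
  {H : Distribution E M}

theorem stableHull_eq_self {𝒱 : Set (LocalVectorField E M)} (h : IsStable 𝒱) :
    stableHull 𝒱 = 𝒱 :=
  Set.Subset.antisymm (Set.sInter_subset_of_mem ⟨subset_rfl, h⟩)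
    (Set.subset_sInter fun _ h𝒲 ↦ h𝒲.1)

theorem Spans.subset_horizontalFields {𝒱 : Set (LocalVectorField E M)} (h : Spans 𝒱 H) :
    𝒱 ⊆ horizontalFields H := fun X hX x hx ↦ by
  rw [h x]
  exact Submodule.subset_span ⟨X, hX, hx, rfl⟩

variable [FiniteDimensional ℝ E]

instance (x : M) : FiniteDimensional ℝ (TangentSpace 𝓘(ℝ, E) x) :=
  inferInstanceAs (FiniteDimensional ℝ E)

variable [T2Space M]

open LocalVectorField

theorem LocalVectorField.IsFlowPullback.toFun_eq {X Y Z : LocalVectorField E M} {t : ℝ}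
    (h : X.IsFlowPullback t Y Z) {x : M} (hx : x ∈ Z.domain) :
    Z.toFun x = mfderiv 𝓘(ℝ, E) 𝓘(ℝ, E) (X.flow (-t)) (X.flow t x) (Y.toFun (X.flow t x)) := by
  have hx' := hx
  rw [h.1] at hx'
  exact (h.2 x hx).trans (inverse_mfderiv_flow_apply hx'.1 _)

/-- Pullbacks are unique, so every stable set in the intersection contains the same field `Z`. -/
theorem isStable_stableHull (𝒱 : Set (LocalVectorField E M)) : IsStable (stableHull 𝒱) := by
  intro X hX Y hY t
  obtain ⟨Z, hZ⟩ := exists_isFlowPullback X t Y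
  refine ⟨Z, fun 𝒲 h𝒲 ↦ ?_, hZ⟩
  obtain ⟨Z', hZ', hp⟩ := h𝒲.2 X (hX 𝒲 h𝒲) Y (hY 𝒲 h𝒲) t
  rwa [hZ.unique hp]

/-- Pulling back along the flow at time `-t` is pushing forward along the flow at time `t`. The flow
thus sends the spanning vectors of `H x` to values of members of `𝒱`, and these lie in `H`. -/
theorem IsStable.subset_infinitesimalAut {𝒱 : Set (LocalVectorField E M)} (h𝒱 : IsStable 𝒱)
    (h : Spans 𝒱 H) : 𝒱 ⊆ infinitesimalAut H := by
  intro X hX t x hx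
  have hle : H x ≤ (H (X.flow t x)).comap
      (mfderiv 𝓘(ℝ, E) 𝓘(ℝ, E) (X.flow t) x).toLinearMap := by
    rw [h x, Submodule.span_le]
    rintro _ ⟨Y, hY, hxY, rfl⟩
    obtain ⟨Z, hZ, hp⟩ := h𝒱 X hX Y hY (-t)
    have hback := flow_neg_flow hx
    have hmem : X.flow t x ∈ Z.domain := by
      rw [hp.1]
      exact ⟨flow_mem_flowDomain_neg hx, by rwa [hback]⟩
    -- Point and time are generalized so that the two identities can be substituted despite the
    -- dependent tangent spaces.
    have heq : ∀ (x' : M) (t' : ℝ), X.flow (-t) (X.flow t x) = x' → - -t = t' →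
        (Z.toFun (X.flow t x) : E) = mfderiv 𝓘(ℝ, E) 𝓘(ℝ, E) (X.flow t') x' (Y.toFun x') := by
      rintro _ _ rfl rfl
      exact hp.toFun_eq hmem
    have := h.subset_horizontalFields hZ _ hmem
    have h2 := heq x t hback (neg_neg t)
    change mfderiv 𝓘(ℝ, E) 𝓘(ℝ, E) (X.flow t) x (Y.toFun x) ∈ H (X.flow t x)
    exact h2 ▸ this
  exact hle

theorem isStable_horizontalFields (h : horizontalFields H ⊆ infinitesimalAut H) :
    IsStable (horizontalFields H) := by
  intro X hX Y hY t
  obtain ⟨Z, hZ⟩ := exists_isFlowPullback X t Y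
  refine ⟨Z, fun x hx ↦ ?_, hZ⟩
  have hx' := hx
  rw [hZ.1] at hx'
  rw [hZ.toFun_eq hx]
  have h1 := h hX (-t) _ (flow_mem_flowDomain_neg hx'.1) _ (hY _ hx'.2)
  rwa [flow_neg_flow hx'.1] at h1

/-- The defining inclusion at time `-t` yields the reverse inclusion at time `t`. -/
theorem map_mfderiv_flow_of_mem_infinitesimalAut {X : LocalVectorField E M}
    (hX : X ∈ infinitesimalAut H) {t : ℝ} {x : M} (hx : x ∈ X.flowDomain t) :
    (H x).map (mfderiv 𝓘(ℝ, E) 𝓘(ℝ, E) (X.flow t) x).toLinearMap = H (X.flow t x) := by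
  refine le_antisymm ?_ fun w hw ↦ ?_
  · rintro _ ⟨w, hw, rfl⟩
    exact hX t x hx w hw
  · have h1 := hX (-t) _ (flow_mem_flowDomain_neg hx) w hw
    rw [flow_neg_flow hx] at h1
    exact ⟨_, h1, mfderiv_flow_apply_neg hx w⟩

theorem finrank_flow_of_mem_infinitesimalAut {X : LocalVectorField E M}
    (hX : X ∈ infinitesimalAut H) {t : ℝ} {x : M} (hx : x ∈ X.flowDomain t) :
    Module.finrank ℝ (H (X.flow t x)) = Module.finrank ℝ (H x) := by
  rw [← map_mfderiv_flow_of_mem_infinitesimalAut hX hx]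
  exact (Submodule.equivMapOfInjective
    (mfderiv 𝓘(ℝ, E) 𝓘(ℝ, E) (X.flow t) x).toLinearMap
    (isInvertible_mfderiv_flow hx).injective (H x)).finrank_eq.symm

theorem LocalVectorField.flow_zero {X : LocalVectorField E M} {x : M} (hx : x ∈ X.domain) :
    X.flow 0 x = x := by
  obtain ⟨γ, a, b, -, -, h0, h1, -⟩ :=
    flowsTo_iff.1 (flowsTo_flow (eventually_flowSmoothAt hx).self_of_nhds.mem)
  exact h1.symm.trans h0

theorem mfderiv_flow_zero {X : LocalVectorField E M} {x : M} (hx : x ∈ X.domain)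
    (w : TangentSpace 𝓘(ℝ, E) x) :
    (mfderiv 𝓘(ℝ, E) 𝓘(ℝ, E) (X.flow 0) x w : E) = w := by
  have h : X.flow 0 =ᶠ[𝓝 x] id := by
    filter_upwards [X.isOpen_domain.mem_nhds hx] with y hy
    exact flow_zero hy
  have h2 := (hasMFDerivAt_id (I := 𝓘(ℝ, E)) x).congr_of_eventuallyEq h
  exact DFunLike.congr_fun h2.mfderiv w

theorem mfderiv_flow_add {X : LocalVectorField E M} {s t : ℝ} {x : M} (hx : x ∈ X.flowDomain s)
    (hy : X.flow s x ∈ X.flowDomain t) (w : TangentSpace 𝓘(ℝ, E) x) :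
    (mfderiv 𝓘(ℝ, E) 𝓘(ℝ, E) (X.flow (s + t)) x w : E) =
      mfderiv 𝓘(ℝ, E) 𝓘(ℝ, E) (X.flow t) (X.flow s x)
        (mfderiv 𝓘(ℝ, E) 𝓘(ℝ, E) (X.flow s) x w) := by
  have h : X.flow (s + t) =ᶠ[𝓝 x] X.flow t ∘ X.flow s := by
    filter_upwards [(X.isOpen_flowDomain s).mem_nhds hx, (contMDiffAt_flow hx).continuousAt.eventually
      ((X.isOpen_flowDomain t).mem_nhds hy)] with y hy1 hy2
    exact ((flowsTo_flow hy1).trans (flowsTo_flow hy2)).flow_eq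
  have h1 := (HasMFDerivAt.comp x (mdifferentiableAt_flow hy).hasMFDerivAt
    (mdifferentiableAt_flow hx).hasMFDerivAt).congr_of_eventuallyEq h
  exact DFunLike.congr_fun (h1.mfderiv) w

end StefanSussmann

/-! ### Plaques and lifts of horizontal fields -/

namespace StefanSussmann

variable {E : Type v} [NormedAddCommGroup E] [NormedSpace ℝ E]
variable {M : Type u} [TopologicalSpace M] [ChartedSpace E M] [IsManifold 𝓘(ℝ, E) ∞ M]
  {H : Distribution E M}
variable {F : Type*} [NormedAddCommGroup F] [NormedSpace ℝ F]

open LocalVectorField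

/-- At `c`, the map `ψ` is an immersion that is tangent to `H` with the full dimension of `H`. -/
structure IsPlaqueAt (H : Distribution E M) (ψ : F → M) (c : F) : Prop where
  smooth : ContMDiffAt 𝓘(ℝ, F) 𝓘(ℝ, E) ∞ ψ c
  injective_mfderiv : Function.Injective (mfderiv 𝓘(ℝ, F) 𝓘(ℝ, E) ψ c)
  range_mfderiv : LinearMap.range (mfderiv 𝓘(ℝ, F) 𝓘(ℝ, E) ψ c).toLinearMap = H (ψ c)

theorem LocalVectorField.inChart_extChartAt (X : LocalVectorField E M) {x₀ z : M}
    (hz : z ∈ (extChartAt 𝓘(ℝ, E) x₀).source) :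
    X.inChart x₀ (extChartAt 𝓘(ℝ, E) x₀ z) =
      mfderiv 𝓘(ℝ, E) 𝓘(ℝ, E) (extChartAt 𝓘(ℝ, E) x₀) z (X.toFun z) := by
  have hinv := isInvertible_mfderiv_extChartAt_symm ((extChartAt 𝓘(ℝ, E) x₀).map_source hz)
  have hcomp := mfderivWithin_extChartAt_symm_comp_mfderiv_extChartAt' (I := 𝓘(ℝ, E)) hz
  rw [modelWithCornersSelf_coe, Set.range_id, mfderivWithin_univ] at hcomp
  have h1 := hinv.self_apply_inverse (X.toFun ((extChartAt 𝓘(ℝ, E) x₀).symm (extChartAt 𝓘(ℝ, E) x₀ z)))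
  have h2 := DFunLike.congr_fun hcomp (X.toFun z)
  have h3 : (X.toFun ((extChartAt 𝓘(ℝ, E) x₀).symm (extChartAt 𝓘(ℝ, E) x₀ z)) : E) = X.toFun z :=
    congrArg (fun y ↦ (X.toFun y : E)) ((extChartAt 𝓘(ℝ, E) x₀).left_inv hz)
  exact hinv.injective ((h1.trans h3).trans h2.symm)

variable [FiniteDimensional ℝ E] [FiniteDimensional ℝ F]

/-- An immersion has a smooth local retraction, linear in a chart. -/
theorem exists_chart_retraction {ψ : F → M} {c₀ : F}
    (hψ : ∀ᶠ c in 𝓝 c₀, ContMDiffAt 𝓘(ℝ, F) 𝓘(ℝ, E) ∞ ψ c)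
    (hinj : Function.Injective (mfderiv 𝓘(ℝ, F) 𝓘(ℝ, E) ψ c₀)) :
    ∃ L : E →L[ℝ] F, ∀ᶠ c in 𝓝 c₀,
      ContDiffAt ℝ ∞ (fun c ↦ L (extChartAt 𝓘(ℝ, E) (ψ c₀) (ψ c))) c ∧
      (fderiv ℝ (fun c ↦ L (extChartAt 𝓘(ℝ, E) (ψ c₀) (ψ c))) c).IsInvertible ∧
      ∀ v : F, fderiv ℝ (fun c ↦ L (extChartAt 𝓘(ℝ, E) (ψ c₀) (ψ c))) c v =
        L (mfderiv 𝓘(ℝ, E) 𝓘(ℝ, E) (extChartAt 𝓘(ℝ, E) (ψ c₀)) (ψ c)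
          (mfderiv 𝓘(ℝ, F) 𝓘(ℝ, E) ψ c v)) := by
  set e := extChartAt 𝓘(ℝ, E) (ψ c₀) with he
  have hsrc : ∀ᶠ c in 𝓝 c₀, ψ c ∈ (chartAt E (ψ c₀)).source :=
    hψ.self_of_nhds.continuousAt.eventually
      ((chartAt E (ψ c₀)).open_source.mem_nhds (mem_chart_source E (ψ c₀)))
  have hg : ∀ᶠ c in 𝓝 c₀, ContDiffAt ℝ ∞ (fun c ↦ e (ψ c)) c ∧
      ∀ v : F, fderiv ℝ (fun c ↦ e (ψ c)) c v =
        mfderiv 𝓘(ℝ, E) 𝓘(ℝ, E) e (ψ c) (mfderiv 𝓘(ℝ, F) 𝓘(ℝ, E) ψ c v) := by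
    filter_upwards [hψ, hsrc] with c hc hcs
    have h1 : ContMDiffAt 𝓘(ℝ, E) 𝓘(ℝ, E) ∞ e (ψ c) := contMDiffAt_extChartAt' hcs
    refine ⟨contMDiffAt_iff_contDiffAt.1 (h1.comp c hc), fun v ↦ ?_⟩
    have h2 := HasMFDerivAt.comp c (h1.mdifferentiableAt (by simp)).hasMFDerivAt
      (hc.mdifferentiableAt (by simp)).hasMFDerivAt
    exact DFunLike.congr_fun (mfderiv_eq_fderiv.symm.trans h2.mfderiv) v
  have hinj' : Function.Injective (fderiv ℝ (fun c ↦ e (ψ c)) c₀) := by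
    have h1 : (fderiv ℝ (fun c ↦ e (ψ c)) c₀ : F → E) = fun v ↦
        mfderiv 𝓘(ℝ, E) 𝓘(ℝ, E) e (ψ c₀) (mfderiv 𝓘(ℝ, F) 𝓘(ℝ, E) ψ c₀ v) :=
      funext hg.self_of_nhds.2
    rw [h1]
    exact (isInvertible_mfderiv_extChartAt (mem_extChartAt_source (ψ c₀))).injective.comp hinj
  -- `L` inverts the derivative of the immersion, read in the chart, on the left at `c₀`. So the
  -- derivative of the composite is the identity at `c₀` and stays invertible nearby.
  obtain ⟨L, hL⟩ := LinearMap.exists_leftInverse_of_injective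
    (fderiv ℝ (fun c ↦ e (ψ c)) c₀).toLinearMap (LinearMap.ker_eq_bot.2 hinj')
  let L' : E →L[ℝ] F := LinearMap.toContinuousLinearMap L
  refine ⟨L', ?_⟩
  have hsm : ∀ᶠ c in 𝓝 c₀, ContDiffAt ℝ ∞ (fun c ↦ L' (e (ψ c))) c ∧
      fderiv ℝ (fun c ↦ L' (e (ψ c))) c = L'.comp (fderiv ℝ (fun c ↦ e (ψ c)) c) := by
    filter_upwards [hg] with c hc
    exact ⟨L'.contDiff.contDiffAt.comp c hc.1,
      (L'.hasFDerivAt.comp c (hc.1.differentiableAt (by simp)).hasFDerivAt).fderiv⟩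
  have hinv : ∀ᶠ c in 𝓝 c₀, (fderiv ℝ (fun c ↦ L' (e (ψ c))) c).IsInvertible := by
    have hc : ContinuousAt (fderiv ℝ (fun c ↦ L' (e (ψ c)))) c₀ :=
      (hsm.self_of_nhds.1.fderiv_right (m := 0) (by simp)).continuousAt
    have h0 : fderiv ℝ (fun c ↦ L' (e (ψ c))) c₀ = ContinuousLinearEquiv.refl ℝ F := by
      rw [hsm.self_of_nhds.2]
      ext v
      exact LinearMap.congr_fun hL v
    exact hc.eventually (by rw [h0]; exact (ContinuousLinearEquiv.refl ℝ F).nhds)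
  filter_upwards [hsm, hinv, hg] with c h1 h2 h3
  refine ⟨h1.1, h2, fun v ↦ ?_⟩
  rw [h1.2, ContinuousLinearMap.comp_apply, h3.2]

/-- A horizontal vector field lifts to a plaque. -/
theorem exists_lift_of_isPlaqueAt {ψ : F → M} {c₀ : F} (hψ : ∀ᶠ c in 𝓝 c₀, IsPlaqueAt H ψ c)
    {X : LocalVectorField E M} (hX : X ∈ horizontalFields H) (hc₀ : ψ c₀ ∈ X.domain) :
    ∃ Y : F → F, ∀ᶠ c in 𝓝 c₀, ContDiffAt ℝ ∞ Y c ∧ ψ c ∈ X.domain ∧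
      mfderiv 𝓘(ℝ, F) 𝓘(ℝ, E) ψ c (Y c) = X.toFun (ψ c) := by
  obtain ⟨L, hL⟩ := exists_chart_retraction (hψ.mono fun c hc ↦ hc.smooth)
    hψ.self_of_nhds.injective_mfderiv
  have hdom : ∀ᶠ c in 𝓝 c₀, ψ c ∈ X.domain :=
    hψ.self_of_nhds.smooth.continuousAt.eventually (X.isOpen_domain.mem_nhds hc₀)
  have hsrc : ∀ᶠ c in 𝓝 c₀, ψ c ∈ (chartAt E (ψ c₀)).source :=
    hψ.self_of_nhds.smooth.continuousAt.eventually
      ((chartAt E (ψ c₀)).open_source.mem_nhds (mem_chart_source E (ψ c₀)))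
  -- The lift solves the equation `Tψ (Y c) = X (ψ c)` after projection by `L`, where it becomes
  -- square and invertible; this makes it smooth. It solves the original equation because `X` is
  -- tangent to the plaque.
  refine ⟨fun c ↦ (fderiv ℝ (fun c ↦ L (extChartAt 𝓘(ℝ, E) (ψ c₀) (ψ c))) c).inverse
    (L (X.inChart (ψ c₀) (extChartAt 𝓘(ℝ, E) (ψ c₀) (ψ c)))), ?_⟩
  filter_upwards [hL, hψ, hdom, hsrc] with c hc hψc hcd hcs
  have hcs' : ψ c ∈ (extChartAt 𝓘(ℝ, E) (ψ c₀)).source := by rwa [extChartAt_source]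
  refine ⟨?_, hcd, ?_⟩
  · have h1 : ContDiffAt ℝ ∞ (fun c ↦ X.inChart (ψ c₀) (extChartAt 𝓘(ℝ, E) (ψ c₀) (ψ c))) c := by
      refine ContDiffAt.comp c (X.contDiffAt_inChart
        ((extChartAt 𝓘(ℝ, E) (ψ c₀)).map_source hcs') ?_) ?_
      · rwa [(extChartAt 𝓘(ℝ, E) (ψ c₀)).left_inv hcs']
      · exact contMDiffAt_iff_contDiffAt.1 ((contMDiffAt_extChartAt' hcs).comp c hψc.smooth)
    obtain ⟨e', he'⟩ := hc.2.1
    have h2 : ContDiffAt ℝ ∞ (fun c ↦ (fderiv ℝ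
        (fun c ↦ L (extChartAt 𝓘(ℝ, E) (ψ c₀) (ψ c))) c).inverse) c := by
      refine ContDiffAt.comp (g := ContinuousLinearMap.inverse) c ?_
        (hc.1.fderiv_right (m := ∞) (by simp))
      rw [← he']
      exact contDiffAt_map_inverse e'
    exact h2.clm_apply (L.contDiff.contDiffAt.comp c h1)
  · have hmem := hX _ hcd
    rw [← hψc.range_mfderiv] at hmem
    obtain ⟨v, hv⟩ : ∃ v : F, mfderiv 𝓘(ℝ, F) 𝓘(ℝ, E) ψ c v = X.toFun (ψ c) := hmem
    rw [X.inChart_extChartAt hcs', ← hv, ← hc.2.2 v]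
    exact congrArg (mfderiv 𝓘(ℝ, F) 𝓘(ℝ, E) ψ c) (hc.2.1.inverse_apply_self v)

variable [T2Space M]

/-- Let `φ` be the flow of the lift of `X`. Differentiating `X.flow s ∘ ψ = ψ ∘ φ s` at `c₀` shows
that the flow maps `H` into `H`. Both spaces have the dimension of `F`, so the inclusion is an
equality. -/
theorem eventually_map_mfderiv_flow_of_isPlaqueAt {ψ : F → M} {c₀ : F}
    (hψ : ∀ᶠ c in 𝓝 c₀, IsPlaqueAt H ψ c)
    {X : LocalVectorField E M} (hX : X ∈ horizontalFields H) (hc₀ : ψ c₀ ∈ X.domain) :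
    ∀ᶠ s in 𝓝 (0 : ℝ), ψ c₀ ∈ X.flowDomain s ∧
      (H (ψ c₀)).map (mfderiv 𝓘(ℝ, E) 𝓘(ℝ, E) (X.flow s) (ψ c₀)).toLinearMap =
        H (X.flow s (ψ c₀)) := by
  obtain ⟨Y, hY⟩ := exists_lift_of_isPlaqueAt hψ hX hc₀
  obtain ⟨φ, hφ⟩ := exists_smooth_local_flow (hY.mono fun c hc ↦ hc.1)
  have hφc : ContinuousAt (fun q : ℝ × F ↦ φ q.1 q.2) (0, c₀) := hφ.self_of_nhds.2.2.continuousAt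
  have hφ0 : φ 0 c₀ = c₀ := hφ.self_of_nhds.1
  have hev : ∀ᶠ q : ℝ × F in 𝓝 (0, c₀), IsPlaqueAt H ψ (φ q.1 q.2) ∧
      ψ (φ q.1 q.2) ∈ X.domain ∧ mfderiv 𝓘(ℝ, F) 𝓘(ℝ, E) ψ (φ q.1 q.2) (Y (φ q.1 q.2)) =
        X.toFun (ψ (φ q.1 q.2)) := by
    refine hφc.eventually (p := fun c ↦ IsPlaqueAt H ψ c ∧ ψ c ∈ X.domain ∧
      mfderiv 𝓘(ℝ, F) 𝓘(ℝ, E) ψ c (Y c) = X.toFun (ψ c)) ?_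
    simp only [hφ0]
    exact hψ.and (hY.mono fun c hc ↦ hc.2)
  obtain ⟨A, hA, B, hB, hAB⟩ := mem_nhds_prod_iff.1 (hφ.and hev)
  obtain ⟨δ, hδ, hδA⟩ := Metric.mem_nhds_iff.1 hA
  rw [Real.ball_eq_Ioo, zero_sub, zero_add] at hδA
  have h0 : (0 : ℝ) ∈ Set.Ioo (-δ) δ := ⟨neg_lt_zero.2 hδ, hδ⟩
  have hflow : ∀ s ∈ Set.Ioo (-δ) δ, ∀ c ∈ B, X.FlowsTo s (ψ c) (ψ (φ s c)) := by
    intro s hs c hc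
    refine flowsTo_iff.2 ⟨fun s ↦ ψ (φ s c), -δ, δ, h0, hs, ?_, rfl, fun r hr ↦ ?_⟩
    · simp only [(hAB (Set.mk_mem_prod (hδA h0) hc)).1.1]
    · obtain ⟨⟨-, h1, -⟩, h2, h3, h4⟩ := hAB (Set.mk_mem_prod (hδA hr) hc)
      refine ⟨h3, ?_⟩
      have := (HasDerivAt.hasVelocityAt h1).comp (M := M) (f := ψ)
        (h2.smooth.mdifferentiableAt (by simp))
      simp only at h4
      rwa [h4] at this
  filter_upwards [Ioo_mem_nhds h0.1 h0.2] with s hs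
  have hc₀B := mem_of_mem_nhds hB
  have hdom : ψ c₀ ∈ X.flowDomain s := ⟨_, hflow s hs c₀ hc₀B⟩
  refine ⟨hdom, ?_⟩
  obtain ⟨⟨-, -, hsm⟩, hp, -, -⟩ := hAB (Set.mk_mem_prod (hδA hs) hc₀B)
  have hp0 := hψ.self_of_nhds
  have hφs : DifferentiableAt ℝ (φ s) c₀ := by
    have h1 : DifferentiableAt ℝ (fun q : ℝ × F ↦ φ q.1 q.2) (s, c₀) :=
      hsm.differentiableAt (by simp)
    exact h1.comp c₀ (f := fun c ↦ (s, c)) (by fun_prop)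
  have heq : X.flow s ∘ ψ =ᶠ[𝓝 c₀] ψ ∘ φ s := by
    filter_upwards [hB] with c hc
    exact (hflow s hs c hc).flow_eq
  have h1 := HasMFDerivAt.comp c₀ (mdifferentiableAt_flow hdom).hasMFDerivAt
    (hp0.smooth.mdifferentiableAt (by simp)).hasMFDerivAt
  have h2 := (HasMFDerivAt.comp c₀ (hp.smooth.mdifferentiableAt (by simp)).hasMFDerivAt
    (hφs.mdifferentiableAt).hasMFDerivAt).congr_of_eventuallyEq heq
  have h3 : ∀ v, (mfderiv 𝓘(ℝ, E) 𝓘(ℝ, E) (X.flow s) (ψ c₀)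
      (mfderiv 𝓘(ℝ, F) 𝓘(ℝ, E) ψ c₀ v) : E) =
      mfderiv 𝓘(ℝ, F) 𝓘(ℝ, E) ψ (φ s c₀) (mfderiv 𝓘(ℝ, F) 𝓘(ℝ, F) (φ s) c₀ v) :=
    fun v ↦ DFunLike.congr_fun (hasMFDerivAt_unique h1 h2) v
  have hfl : X.flow s (ψ c₀) = ψ (φ s c₀) := (hflow s hs c₀ hc₀B).flow_eq
  have hdim : ∀ y, (∃ c, IsPlaqueAt H ψ c ∧ y = ψ c) →
      Module.finrank ℝ (H y) = Module.finrank ℝ F := by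
    rintro _ ⟨c, hc, rfl⟩
    rw [← hc.range_mfderiv]
    exact LinearMap.finrank_range_of_inj hc.injective_mfderiv
  refine Submodule.eq_of_le_of_finrank_eq ?_ ?_
  · rintro _ ⟨w, hw, rfl⟩
    have hw' : w ∈ H (ψ c₀) := hw
    rw [← hp0.range_mfderiv] at hw'
    obtain ⟨v, rfl⟩ := hw'
    rw [hfl, ← hp.range_mfderiv]
    exact ⟨_, (h3 v).symm⟩
  · rw [hdim (X.flow s (ψ c₀)) ⟨_, hp, hfl⟩, ← hdim (ψ c₀) ⟨_, hp0, rfl⟩]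
    exact (Submodule.equivMapOfInjective
      (mfderiv 𝓘(ℝ, E) 𝓘(ℝ, E) (X.flow s) (ψ c₀)).toLinearMap
      (isInvertible_mfderiv_flow hdom).injective (H (ψ c₀))).finrank_eq.symm

end StefanSussmann

/-! ### Integrability through plaques, and plaques from compositions of flows -/

namespace StefanSussmann

variable {E : Type v} [NormedAddCommGroup E] [NormedSpace ℝ E]
variable {M : Type u} [TopologicalSpace M] [ChartedSpace E M]
  {H : Distribution E M}

open LocalVectorField

/-- An integral manifold is parametrized locally by a plaque. -/
theorem IsIntegrable.exists_isPlaqueAt (h : IsIntegrable H) (x : M) :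
    ∃ (k : ℕ) (ψ : EuclideanSpace ℝ (Fin k) → M) (c₀ : EuclideanSpace ℝ (Fin k)),
      ψ c₀ = x ∧ ∀ᶠ c in 𝓝 c₀, IsPlaqueAt H ψ c := by
  obtain ⟨k, N, _, _, _, _, _, i, hi, n, rfl⟩ := h x
  refine ⟨k, i ∘ (extChartAt (𝓡 k) n).symm, extChartAt (𝓡 k) n n,
    congrArg i (extChartAt_to_inv n), ?_⟩
  filter_upwards [extChartAt_target_mem_nhds n] with c hc
  have hsm := contMDiffAt_extChartAt_symm hc
  have hinv := isInvertible_mfderiv_extChartAt_symm hc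
  have hd := mfderiv_comp c ((hi.smooth ((extChartAt (𝓡 k) n).symm c)).mdifferentiableAt (by simp))
    (hsm.mdifferentiableAt (by simp))
  refine ⟨(hi.smooth _).comp c hsm, ?_, ?_⟩
  · rw [hd]
    exact (hi.injective_mfderiv _).comp hinv.injective
  · rw [hd]
    refine Eq.trans ?_ (hi.range_mfderiv ((extChartAt (𝓡 k) n).symm c))
    exact LinearMap.range_comp_of_range_eq_top _ (LinearMap.range_eq_top.2 hinv.surjective)

variable [IsManifold 𝓘(ℝ, E) ∞ M] [FiniteDimensional ℝ E]

/-- After the chart and the projection `L`, the plaque becomes a local diffeomorphism, which is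
locally injective. -/
theorem eventually_injOn_of_isPlaqueAt {F : Type*} [NormedAddCommGroup F] [NormedSpace ℝ F]
    [FiniteDimensional ℝ F] {ψ : F → M} {c₀ : F} (hψ : ∀ᶠ c in 𝓝 c₀, IsPlaqueAt H ψ c) :
    ∃ U ∈ 𝓝 c₀, Set.InjOn ψ U := by
  obtain ⟨L, hL⟩ := exists_chart_retraction (hψ.mono fun c hc ↦ hc.smooth)
    hψ.self_of_nhds.injective_mfderiv
  obtain ⟨h1, ⟨e, he⟩, -⟩ := hL.self_of_nhds
  have h2 : HasStrictFDerivAt (fun c ↦ L (extChartAt 𝓘(ℝ, E) (ψ c₀) (ψ c))) (e : F →L[ℝ] F) c₀ := by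
    rw [he]
    exact h1.hasStrictFDerivAt (by simp)
  refine ⟨_, (h2.toOpenPartialHomeomorph _).open_source.mem_nhds
    h2.mem_toOpenPartialHomeomorph_source, fun c hc c' hc' hcc ↦ ?_⟩
  refine (h2.toOpenPartialHomeomorph _).injOn hc hc' ?_
  change L _ = L _
  rw [hcc]

theorem eventually_injective_mfderiv {F : Type*} [NormedAddCommGroup F] [NormedSpace ℝ F]
    [FiniteDimensional ℝ F] {ψ : F → M} {c₀ : F}
    (hψ : ∀ᶠ c in 𝓝 c₀, ContMDiffAt 𝓘(ℝ, F) 𝓘(ℝ, E) ∞ ψ c)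
    (hinj : Function.Injective (mfderiv 𝓘(ℝ, F) 𝓘(ℝ, E) ψ c₀)) :
    ∀ᶠ c in 𝓝 c₀, Function.Injective (mfderiv 𝓘(ℝ, F) 𝓘(ℝ, E) ψ c) := by
  obtain ⟨L, hL⟩ := exists_chart_retraction hψ hinj
  filter_upwards [hL] with c ⟨_, h1, h2⟩
  intro v w hvw
  exact h1.injective ((h2 v).trans ((congrArg
    (fun u ↦ L (mfderiv 𝓘(ℝ, E) 𝓘(ℝ, E) (extChartAt 𝓘(ℝ, E) (ψ c₀)) (ψ c) u)) hvw).trans (h2 w).symm))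
/-- A distribution with a plaque through every point is integrable. -/
theorem isIntegrable_of_exists_isPlaqueAt
    (h : ∀ x : M, ∃ (k : ℕ) (ψ : EuclideanSpace ℝ (Fin k) → M) (c₀ : EuclideanSpace ℝ (Fin k)),
      ψ c₀ = x ∧ ∀ᶠ c in 𝓝 c₀, IsPlaqueAt H ψ c) : IsIntegrable H := by
  intro x
  obtain ⟨k, ψ, c₀, rfl, hψ⟩ := h x
  obtain ⟨U, hU, hinj⟩ := eventually_injOn_of_isPlaqueAt hψ
  obtain ⟨r, hr, hball⟩ := Metric.mem_nhds_iff.1 (Filter.inter_mem hψ hU)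
  -- The integral manifold is a small ball of parameters with a single chart, lifted to the universe
  -- of `M`.
  let N : Type u := ULift.{u} (Metric.ball c₀ r)
  let j : N → EuclideanSpace ℝ (Fin k) := fun n ↦ n.down
  have hj : Topology.IsOpenEmbedding j :=
    Metric.isOpen_ball.isOpenEmbedding_subtypeVal.comp Homeomorph.ulift.isOpenEmbedding
  let n₀ : N := ⟨c₀, Metric.mem_ball_self hr⟩
  have : Nonempty N := ⟨n₀⟩
  let _ : ChartedSpace (EuclideanSpace ℝ (Fin k)) N := hj.singletonChartedSpace
  have hman : IsManifold (𝓡 k) ∞ N := hj.isManifold_singleton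
  have hjsm : ContMDiff (𝓡 k) (𝓡 k) ∞ j := contMDiff_isOpenEmbedding hj
  have hext : ∀ n : N, (extChartAt (𝓡 k) n : N → EuclideanSpace ℝ (Fin k)) = j := fun n ↦ by
    rw [extChartAt_coe]
    exact hj.singletonChartedSpace_chartAt_eq (x := n)
  have hjinv : ∀ n : N, (mfderiv (𝓡 k) (𝓡 k) j n).IsInvertible := fun n ↦ by
    have := isInvertible_mfderiv_extChartAt (I := 𝓡 k) (mem_extChartAt_source n)
    rwa [hext] at this
  have hp : ∀ n : N, IsPlaqueAt H ψ (j n) := fun n ↦ (hball n.down.2).1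
  have hd : ∀ n : N, mfderiv (𝓡 k) 𝓘(ℝ, E) (ψ ∘ j) n =
      (mfderiv (𝓡 k) 𝓘(ℝ, E) ψ (j n)).comp (mfderiv (𝓡 k) (𝓡 k) j n) := fun n ↦
    mfderiv_comp n ((hp n).smooth.mdifferentiableAt (by simp))
      ((hjsm n).mdifferentiableAt (by simp))
  have hconn : ConnectedSpace (Metric.ball c₀ r) :=
    isConnected_iff_connectedSpace.1 ((convex_ball c₀ r).isConnected ⟨c₀, Metric.mem_ball_self hr⟩)
  refine ⟨k, N, inferInstance, inferInstance, hman, hj.toIsEmbedding.t2Space,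
    Homeomorph.ulift.isClosedEmbedding.paracompactSpace, ψ ∘ j, ⟨?_, ?_, ?_, ?_, ?_⟩, n₀, rfl⟩
  · exact Homeomorph.ulift.symm.surjective.connectedSpace Homeomorph.ulift.symm.continuous
  · exact fun n ↦ (hp n).smooth.comp n (hjsm n)
  · intro n n' hnn
    exact hj.injective (hinj (hball n.down.2).2 (hball n'.down.2).2 hnn)
  · intro n
    rw [hd]
    exact (hp n).injective_mfderiv.comp (hjinv n).injective
  · intro n
    rw [hd]
    refine Eq.trans ?_ (hp n).range_mfderiv
    exact LinearMap.range_comp_of_range_eq_top _ (LinearMap.range_eq_top.2 (hjinv n).surjective)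

variable [T2Space M]

theorem IsIntegrable.eventually_map_mfderiv_flow (h : IsIntegrable H)
    {X : LocalVectorField E M}
    (hX : X ∈ horizontalFields H) {x : M} (hx : x ∈ X.domain) :
    ∀ᶠ s in 𝓝 (0 : ℝ), x ∈ X.flowDomain s ∧
      (H x).map (mfderiv 𝓘(ℝ, E) 𝓘(ℝ, E) (X.flow s) x).toLinearMap = H (X.flow s x) := by
  obtain ⟨k, ψ, c₀, rfl, hψ⟩ := h.exists_isPlaqueAt x
  exact eventually_map_mfderiv_flow_of_isPlaqueAt hψ hX hx

/-- Short times are handled by plaques around each point of the trajectory; connectedness of the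
time interval does the rest. -/
theorem IsIntegrable.horizontalFields_subset (h : IsIntegrable H) :
    horizontalFields H ⊆ infinitesimalAut H := by
  intro X hX t x hx w hw
  suffices hmap : (H x).map (mfderiv 𝓘(ℝ, E) 𝓘(ℝ, E) (X.flow t) x).toLinearMap =
      H (X.flow t x) by
    rw [← hmap]
    exact ⟨w, hw, rfl⟩
  obtain ⟨γ, a, b, h0, ht, rfl, -, hγ⟩ := flowsTo_iff.1 (flowsTo_flow hx)
  have hγd : ∀ s ∈ Set.Ioo a b, X.FlowsTo s (γ 0) (γ s) := fun s hs ↦ by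
    simpa using hγ.flowsTo h0 hs
  -- Equality rather than inclusion: an isomorphism between nearby fibres of `H` then makes `Q`
  -- locally constant in time.
  let Q : ℝ → Prop := fun s ↦ (H (γ 0)).map
    (mfderiv 𝓘(ℝ, E) 𝓘(ℝ, E) (X.flow s) (γ 0)).toLinearMap = H (X.flow s (γ 0))
  refine isPreconnected_Ioo.induction₂' (fun s t ↦ Q s → Q t) ?_
    (fun _ _ _ _ _ _ h1 h2 ↦ h2 ∘ h1) h0 ht
    (h.eventually_map_mfderiv_flow hX (hγ 0 h0).1).self_of_nhds.2
  intro s hs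
  have hsx : γ 0 ∈ X.flowDomain s := ⟨_, hγd s hs⟩
  have hev := h.eventually_map_mfderiv_flow hX (flow_mem_domain hsx)
  have hev' : ∀ᶠ r in 𝓝 s, X.flow s (γ 0) ∈ X.flowDomain (r - s) ∧
      (H (X.flow s (γ 0))).map
        (mfderiv 𝓘(ℝ, E) 𝓘(ℝ, E) (X.flow (r - s)) (X.flow s (γ 0))).toLinearMap =
        H (X.flow (r - s) (X.flow s (γ 0))) := by
    have hc : Filter.Tendsto (fun r ↦ r - s) (𝓝 s) (𝓝 0) := by
      simpa using (continuous_sub_right s).tendsto s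
    exact hc.eventually hev
  refine Filter.Eventually.filter_mono nhdsWithin_le_nhds ?_
  filter_upwards [hev'] with r ⟨hr, hmap⟩
  have hflow : X.flow (r - s) (X.flow s (γ 0)) = X.flow r (γ 0) := by
    have := ((flowsTo_flow hsx).trans (flowsTo_flow hr)).flow_eq
    rw [add_sub_cancel] at this
    exact this.symm
  have hcomp : (H (γ 0)).map (mfderiv 𝓘(ℝ, E) 𝓘(ℝ, E) (X.flow r) (γ 0)).toLinearMap =
      ((H (γ 0)).map (mfderiv 𝓘(ℝ, E) 𝓘(ℝ, E) (X.flow s) (γ 0)).toLinearMap).map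
        (mfderiv 𝓘(ℝ, E) 𝓘(ℝ, E) (X.flow (r - s)) (X.flow s (γ 0))).toLinearMap := by
    have h1 := mfderiv_flow_add hsx hr
    rw [add_sub_cancel] at h1
    rw [← Submodule.map_comp]
    exact congrArg (fun f ↦ (H (γ 0)).map f) (LinearMap.ext h1)
  have hH : (H (X.flow r (γ 0)) : Submodule ℝ E) = H (X.flow (r - s) (X.flow s (γ 0))) :=
    hflow ▸ rfl
  have hiff : Q r ↔ Q s := by
    change (_ = _) ↔ (_ = _)
    rw [hcomp]
    have hinj := Submodule.map_injective_of_injective (f := (mfderiv 𝓘(ℝ, E) 𝓘(ℝ, E)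
      (X.flow (r - s)) (X.flow s (γ 0))).toLinearMap) (isInvertible_mfderiv_flow hr).injective
    constructor
    · intro h1
      exact hinj (h1.trans (hH.trans hmap.symm))
    · intro h1
      rw [h1]
      exact hmap.trans hH.symm
  exact ⟨hiff.2, hiff.1⟩


/-- The derivative of a flow with parameters in the time and in the initial point. -/
theorem mfderiv_flow_comp_apply {P : Type*} [NormedAddCommGroup P] [NormedSpace ℝ P]
    {X : LocalVectorField E M} {f : P → M} (τ : P →L[ℝ] ℝ) {p : P}
    (hf : ContMDiffAt 𝓘(ℝ, P) 𝓘(ℝ, E) ∞ f p) (hp : f p ∈ X.flowDomain (τ p)) :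
    ContMDiffAt 𝓘(ℝ, P) 𝓘(ℝ, E) ∞ (fun q ↦ X.flow (τ q) (f q)) p ∧ ∀ v : P,
    (mfderiv 𝓘(ℝ, P) 𝓘(ℝ, E) (fun q ↦ X.flow (τ q) (f q)) p v : E) =
      τ v • X.toFun (X.flow (τ p) (f p)) +
        mfderiv 𝓘(ℝ, E) 𝓘(ℝ, E) (X.flow (τ p)) (f p) (mfderiv 𝓘(ℝ, P) 𝓘(ℝ, E) f p v) := by
  have hτ : ContMDiffAt 𝓘(ℝ, P) 𝓘(ℝ, ℝ) ∞ τ p := τ.contMDiff.contMDiffAt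
  have hfl := (flowSmoothAt hp).2
  refine ⟨hfl.comp p (hτ.prodMk hf), fun v ↦ ?_⟩
  have h1 := mfderiv_comp p (hfl.mdifferentiableAt (by simp))
    ((hτ.prodMk hf).mdifferentiableAt (by simp))
  have h2 := DFunLike.congr_fun h1 v
  refine h2.trans ?_
  have h3 := (hτ.mdifferentiableAt (by simp)).mfderiv_prod (hf.mdifferentiableAt (by simp))
  refine (mfderiv_prod_eq_add_apply (hfl.mdifferentiableAt (by simp))).trans ?_
  rw [h3]
  have h4 := (hasVelocityAt_flow hp).mfderiv
  have h5 : mfderiv 𝓘(ℝ, P) 𝓘(ℝ, ℝ) τ p v = τ v :=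
    DFunLike.congr_fun (mfderiv_eq_fderiv.trans τ.fderiv) v
  exact congrArg₂ (· + ·) ((DFunLike.congr_fun h4 _).trans
    (congrArg (fun r : ℝ ↦ r • X.toFun (X.flow (τ p) (f p))) h5)) rfl

/-- Composition of the flows of finitely many infinitesimal automorphisms. -/
theorem exists_flow_composition {ι : Type*} [Fintype ι] {X : ι → LocalVectorField E M}
    (hX : ∀ i, X i ∈ infinitesimalAut H ∩ horizontalFields H) {x₀ : M}
    (hx₀ : ∀ i, x₀ ∈ (X i).domain) (s : Finset ι) :
    ∃ f : EuclideanSpace ℝ ι → M, f 0 = x₀ ∧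
      (∀ v : EuclideanSpace ℝ ι, (mfderiv 𝓘(ℝ, EuclideanSpace ℝ ι) 𝓘(ℝ, E) f 0 v : E) =
        ∑ i ∈ s, v i • (X i).toFun x₀) ∧
      ∀ᶠ p in 𝓝 0, ContMDiffAt 𝓘(ℝ, EuclideanSpace ℝ ι) 𝓘(ℝ, E) ∞ f p ∧
        Module.finrank ℝ (H (f p)) = Module.finrank ℝ (H x₀) ∧
        ∀ v : EuclideanSpace ℝ ι, mfderiv 𝓘(ℝ, EuclideanSpace ℝ ι) 𝓘(ℝ, E) f p v ∈ H (f p) := by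
  classical
  induction s using Finset.induction_on with
  | empty =>
    refine ⟨fun _ ↦ x₀, rfl, fun v ↦ ?_, .of_forall fun p ↦ ⟨contMDiffAt_const, rfl, fun v ↦ ?_⟩⟩
    · rw [mfderiv_const]; rfl
    · rw [mfderiv_const]; exact (H x₀).zero_mem
  | insert i s hi ih =>
    obtain ⟨f, hf0, hfd, hf⟩ := ih
    -- The `i`-th coordinate is the time of the flow of `X i`, applied after the flows already
    -- composed.
    let τ : EuclideanSpace ℝ ι →L[ℝ] ℝ := EuclideanSpace.proj i
    have hdom : ∀ᶠ p in 𝓝 (0 : EuclideanSpace ℝ ι), f p ∈ (X i).flowDomain (τ p) := by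
      have hc : Filter.Tendsto (fun p ↦ (τ p, f p)) (𝓝 0) (𝓝 (0, x₀)) := by
        have h1 : ContinuousAt (fun p ↦ (τ p, f p)) 0 :=
          τ.continuous.continuousAt.prodMk hf.self_of_nhds.1.continuousAt
        simpa [ContinuousAt, hf0] using h1
      filter_upwards [hc.eventually (eventually_flowSmoothAt (hx₀ i))] with p hp
      exact hp.mem
    refine ⟨fun p ↦ (X i).flow (τ p) (f p), ?_, fun v ↦ ?_, ?_⟩
    · simp only [map_zero, hf0, flow_zero (hx₀ i)]
    · have h1 := (mfderiv_flow_comp_apply τ hf.self_of_nhds.1 hdom.self_of_nhds).2 v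
      rw [Finset.sum_insert hi, ← hfd v, h1]
      have hflow : (X i).flow (τ 0) (f 0) = x₀ := by rw [map_zero, hf0, flow_zero (hx₀ i)]
      refine congrArg₂ (· + ·) ?_ ?_
      · exact congrArg (fun y ↦ (v i • (X i).toFun y : E)) hflow
      · have h2 := mfderiv_flow_zero (X := X i) (x := f 0) (hf0 ▸ hx₀ i)
          (mfderiv 𝓘(ℝ, EuclideanSpace ℝ ι) 𝓘(ℝ, E) f 0 v)
        rwa [← map_zero τ] at h2
    · filter_upwards [hf, hdom] with p hp hpd
      obtain ⟨h1, h2⟩ := mfderiv_flow_comp_apply τ hp.1 hpd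
      refine ⟨h1, ?_, fun v ↦ ?_⟩
      · rw [finrank_flow_of_mem_infinitesimalAut (hX i).1 hpd, hp.2.1]
      · rw [h2 v]
        -- The time direction lies in `H` because `X i` is horizontal, the transported directions
        -- because its flow preserves `H`.
        exact (H _).add_mem ((H _).smul_mem _ ((hX i).2 _ (flow_mem_domain hpd)))
          ((hX i).1 _ _ hpd _ (hp.2.2 v))

/-- A distribution that is spanned by infinitesimal automorphisms is integrable. -/
theorem isIntegrable_of_spans {𝒲 : Set (LocalVectorField E M)} (hspan : Spans 𝒲 H)
    (h𝒲 : 𝒲 ⊆ infinitesimalAut H) : IsIntegrable H := by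
  refine isIntegrable_of_exists_isPlaqueAt fun x₀ ↦ ?_
  let S : Set (TangentSpace 𝓘(ℝ, E) x₀) := {w | ∃ X ∈ 𝒲, x₀ ∈ X.domain ∧ X.toFun x₀ = w}
  -- A basis of `H x₀` taken from the values of fields in `𝒲`; its size is the dimension of the
  -- plaque.
  obtain ⟨b, hbS, -, hbi⟩ := Submodule.exists_fun_fin_finrank_span_eq ℝ S
  choose X hXW hXd hXb using hbS
  have hfin : Module.finrank ℝ (H x₀) = Module.finrank ℝ (Submodule.span ℝ S) := by
    rw [hspan x₀]
  obtain ⟨f, hf0, hfd, hf⟩ := exists_flow_composition (X := X)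
    (fun i ↦ ⟨h𝒲 (hXW i), hspan.subset_horizontalFields (hXW i)⟩) hXd Finset.univ
  refine ⟨_, f, 0, hf0, ?_⟩
  have hinj : Function.Injective (mfderiv 𝓘(ℝ, EuclideanSpace ℝ (Fin (Module.finrank ℝ
      (Submodule.span ℝ S)))) 𝓘(ℝ, E) f 0) := by
    refine (injective_iff_map_eq_zero _).2 fun (v : EuclideanSpace ℝ (Fin _)) hv ↦ ?_
    have h1 : ∑ i, v i • b i = 0 := by
      have h2 := (hfd v).symm.trans hv
      simp only [hXb] at h2
      exact h2
    have h3 := Fintype.linearIndependent_iff.1 hbi (fun i ↦ v i) h1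
    exact PiLp.ext h3
  filter_upwards [hf, eventually_injective_mfderiv (hf.mono fun p hp ↦ hp.1) hinj] with p hp hpi
  -- The range lies in `H (f p)`, which has the same dimension as `H x₀`, while injectivity gives
  -- the range that dimension.
  refine ⟨hp.1, hpi, Submodule.eq_of_le_of_finrank_eq ?_ ?_⟩
  · rintro _ ⟨v, rfl⟩
    exact hp.2.2 v
  · rw [hp.2.1, hfin]
    refine (LinearMap.finrank_range_of_inj hpi).trans ?_
    exact finrank_euclideanSpace_fin

end StefanSussmann

/-! ### The equivalence -/

theorem mainTheorem5 {E : Type v} [NormedAddCommGroup E] [NormedSpace ℝ E] [FiniteDimensional ℝ E]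
    {M : Type u} [TopologicalSpace M] [ChartedSpace E M] [IsManifold 𝓘(ℝ, E) ∞ M]
    [T2Space M] [ParacompactSpace M]
    (H : StefanSussmann.Distribution E M) (hH : StefanSussmann.IsSmoothDistribution H) :
    List.TFAE [
      StefanSussmann.IsIntegrable H,
      StefanSussmann.IsStable (StefanSussmann.horizontalFields H),
      ∃ 𝒱 : Set (StefanSussmann.LocalVectorField E M),
        StefanSussmann.Spans (StefanSussmann.stableHull 𝒱) H,
      StefanSussmann.Spans
        (StefanSussmann.infinitesimalAut H ∩ StefanSussmann.horizontalFields H) H] := by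
  tfae_have 1 → 2 := fun h ↦
    StefanSussmann.isStable_horizontalFields h.horizontalFields_subset
  tfae_have 2 → 3 := fun h ↦
    -- A stable set is its own hull, and smoothness of `H` says that the horizontal fields span it.
    ⟨StefanSussmann.horizontalFields H, by rwa [StefanSussmann.stableHull_eq_self h]⟩
  tfae_have 2 → 4 := fun h ↦ by
    rwa [Set.inter_eq_right.2 (h.subset_infinitesimalAut hH)]
  tfae_have 3 → 1 := fun ⟨𝒱, h⟩ ↦ StefanSussmann.isIntegrable_of_spans h
    ((StefanSussmann.isStable_stableHull 𝒱).subset_infinitesimalAut h)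
  tfae_have 4 → 1 := fun h ↦ StefanSussmann.isIntegrable_of_spans h Set.inter_subset_left
  tfae_finish
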